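/- Let $V$ be a finite set of variables and $Pred$ a set of predicate symbols with arities $ar(P)\in\mathbb N$. The formulas of $\mathsf{LFD}^{\equiv}$ are $$\varphi ::= P(x_1,\dots,x_k)\mid x\equiv y\mid\neg\varphi\mid\varphi\wedge\varphi\mid \mathsf D_X\varphi\mid D_Xy,$$ where $x,y,x_i\in V$, $k=ar(P)$ and $X\subseteq V$ is finite (possibly empty); $\varphi\to\psi$ abbreviates $\neg(\varphi\wedge\neg\psi)$ and $D_XY$ abbreviates $\bigwedge_{y\in Y}D_Xy$. A model $(O,I,A)$ consists of a set $O$, relations $I(P)\subseteq O^{ar(P)}$ and a set $A\subseteq O^V$ of admissible assignments (states). Write $s=_Xt$ if $s(x)=t(x)$ for all $x\in X$. Truth at $s\in A$ is defined by the usual Boolean clauses and - $s\models P(x_1,\dots,x_k)$ iff $(s(x_1),\dots,s(x_k))\in I(P)$; - $s\models x\equiv y$ iff $t(x)=t(y)$ for all $t\in A$; - $s\models \mathsf D_X\varphi$ iff $t\models\varphi$ for all $t\in A$ with $s=_Xt$; - $s\models D_Xy$ iff $s(y)=t(y)$ for all $t\in A$ with $s=_Xt$. A formula is satisfiable if it is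 true at some state of some model, and valid if it is true at all states of all models. The proof system $\mathbf{LFD}^{\equiv}$ has as axioms all instances of classical tautologies and all formulas - $\mathsf D_X(\varphi\to\psi)\to(\mathsf D_X\varphi\to\mathsf D_X\psi)$; - $P(x_1,\dots,x_n)\to\mathsf D_{\{x_1,\dots,x_n\}}P(x_1,\dots,x_n)$ and $D_Xy\to\mathsf D_XD_Xy$; - $\mathsf D_X\varphi\to\varphi$, $\ \mathsf D_X\varphi\to\mathsf D_X\mathsf D_X\varphi$, $\ \neg\mathsf D_X\varphi\to\mathsf D_X\neg\mathsf D_X\varphi$; - $D_Xx$ for $x\in X$, $\ D_XY\wedge D_YZ\to D_XZ$, $\ D_XY\wedge\mathsf D_Y\varphi\to\mathsf D_X\varphi$; - (Reflexivity of Identity) $x\equiv x$; - (Substitution of Identicals) $x\equiv y\to(\varphi\to\psi)$, where $\psi$ is obtained by substituting $y$ for some occurrence of $x$ in $\varphi$; and as rules modus ponens and necessitation (from $\varphi$ infer $\mathsf D_X\varphi$). Then: 1. The satisfiability problem of $\mathsf{LFD}^{\equiv}$ is decidable: if $Pred$ is effectively (primitive recursively) coded by natural numbers and $ar$ is computable,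 then the set of Gödel numbers of satisfiable formulas is computable. 2. $\mathbf{LFD}^{\equiv}$ is sound and complete, for every set $Pred$: a formula is provable in $\mathbf{LFD}^{\equiv}$ if and only if it is valid (so, equivalently, a formula is consistent if and only if it is satisfiable). -/

import Mathlib

universe u v w

namespace LFD

/-- Formulas of the logic of functional dependence with global identity atoms, over variables `V`
and predicate symbols `Pred` of arities `ar`. Terms are just variables, and the finite sets `X`
of terms may be empty. -/
inductive Formula (V : Type u) {Pred : Type v} (ar : Pred → ℕ) : Type (max u v)
  /-- `P(x₁, …, x_k)` -/
  | atom (P : Pred) (x : Fin (ar P) → V) : Formula V ar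
  /-- `x ≡ y` -/
  | ident (x y : V) : Formula V ar
  | neg (φ : Formula V ar) : Formula V ar
  | and (φ ψ : Formula V ar) : Formula V ar
  /-- the dependence quantifier `𝖣_X φ` -/
  | box (X : Finset V) (φ : Formula V ar) : Formula V ar
  /-- the dependence atom `D_X y` -/
  | dep (X : Finset V) (y : V) : Formula V ar

section Semantics

variable {V : Type u} {Pred : Type v} {ar : Pred → ℕ}

/-- A dependence model: a domain of objects, an interpretation of the predicate symbols, and a
set of admissible assignments, which are the states of the model. -/
structure Model (V : Type u) {Pred : Type v} (ar : Pred → ℕ) where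
  Obj : Type w
  interp : (P : Pred) → (Fin (ar P) → Obj) → Prop
  states : Set (V → Obj)

/-- `X`-value agreement `s =_X t`. -/
def Agree {O : Type w} (X : Finset V) (s t : V → O) : Prop :=
  ∀ x ∈ X, s x = t x

/-- Truth of a formula in a model at an assignment (meant for admissible ones). -/
def Holds (M : Model.{u, v, w} V ar) : (V → M.Obj) → Formula V ar → Prop
  | s, .atom P x => M.interp P (fun i => s (x i))
  | _, .ident x y => ∀ t ∈ M.states, t x = t y
  | s, .neg φ => ¬ Holds M s φ
  | s, .and φ ψ => Holds M s φ ∧ Holds M s ψ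
  | s, .box X φ => ∀ t ∈ M.states, Agree X s t → Holds M t φ
  | s, .dep X y => ∀ t ∈ M.states, Agree X s t → s y = t y

/-- `φ` is true at some state of some model. -/
def Satisfiable (φ : Formula V ar) : Prop :=
  ∃ M : Model.{u, v, w} V ar, ∃ s ∈ M.states, Holds M s φ

/-- `φ` is true at all states of all models. -/
def Valid (φ : Formula V ar) : Prop :=
  ∀ M : Model.{u, v, w} V ar, ∀ s ∈ M.states, Holds M s φ

end Semantics

section ProofSystem

variable {V : Type u} {Pred : Type v} {ar : Pred → ℕ}

/-- Material implication. -/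
def Formula.imp (φ ψ : Formula V ar) : Formula V ar :=
  .neg (.and φ (.neg ψ))

/-- Instances of classical propositional tautologies: the formulas true under every valuation of
formulas that respects the Boolean connectives. -/
def Tautology (φ : Formula V ar) : Prop :=
  ∀ val : Formula V ar → Prop,
    (∀ ψ, val (.neg ψ) ↔ ¬ val ψ) →
    (∀ ψ χ, val (.and ψ χ) ↔ val ψ ∧ val χ) →
    val φ

/-- The conjunction `D_X y₁ ∧ (… ∧ (D_X y_k ∧ ψ))`, that is, `D_X Y ∧ ψ` for `Y = {y₁, …, y_k}`
(just `ψ` when `Y` is empty). -/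
def depAnd (X : Finset V) (ys : List V) (ψ : Formula V ar) : Formula V ar :=
  ys.foldr (fun y χ => .and (.dep X y) χ) ψ

variable [DecidableEq V]

/-- The set `X` with its element `x` replaced by `y`. -/
def replaceIn (x y : V) (X : Finset V) : Finset V := insert y (X.erase x)

/-- `Replace x y φ ψ`: `ψ` is obtained by substituting `y` for one occurrence of `x` in `φ`. -/
inductive Replace (x y : V) : Formula V ar → Formula V ar → Prop
  | atom (P : Pred) (z : Fin (ar P) → V) (i : Fin (ar P)) (h : z i = x) :
      Replace x y (.atom P z) (.atom P (Function.update z i y))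
  | identLeft (z : V) : Replace x y (.ident x z) (.ident y z)
  | identRight (z : V) : Replace x y (.ident z x) (.ident z y)
  | neg {φ ψ : Formula V ar} (h : Replace x y φ ψ) : Replace x y (.neg φ) (.neg ψ)
  | andLeft {φ ψ : Formula V ar} (χ : Formula V ar) (h : Replace x y φ ψ) :
      Replace x y (.and φ χ) (.and ψ χ)
  | andRight {φ ψ : Formula V ar} (χ : Formula V ar) (h : Replace x y φ ψ) :
      Replace x y (.and χ φ) (.and χ ψ)
  | boxSet (X : Finset V) (φ : Formula V ar) (h : x ∈ X) :
      Replace x y (.box X φ) (.box (replaceIn x y X) φ)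
  | boxBody (X : Finset V) {φ ψ : Formula V ar} (h : Replace x y φ ψ) :
      Replace x y (.box X φ) (.box X ψ)
  | depSet (X : Finset V) (z : V) (h : x ∈ X) :
      Replace x y (.dep X z) (.dep (replaceIn x y X) z)
  | depVar (X : Finset V) : Replace x y (.dep X x) (.dep X y)

/-- Provability in the Hilbert system: the system for the logic of functional dependence, together
with Reflexivity of Identity and Substitution of Identicals. -/
inductive Provable : Formula V ar → Prop
  | taut {φ : Formula V ar} (h : Tautology φ) : Provable φ
  | modusPonens {φ ψ : Formula V ar} (h₁ : Provable (φ.imp ψ)) (h₂ : Provable φ) : Provable ψ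
  /-- Distribution: `𝖣_X (φ → ψ) → (𝖣_X φ → 𝖣_X ψ)` -/
  | boxDist (X : Finset V) (φ ψ : Formula V ar) :
      Provable ((Formula.box X (φ.imp ψ)).imp ((Formula.box X φ).imp (.box X ψ)))
  /-- Introduction₁: `P(x₁, …, x_n) → 𝖣_{x₁, …, x_n} P(x₁, …, x_n)` -/
  | boxIntroAtom (P : Pred) (x : Fin (ar P) → V) :
      Provable ((Formula.atom P x).imp (.box (Finset.univ.image x) (.atom P x)))
  /-- Introduction₂: `D_X y → 𝖣_X D_X y` -/
  | boxIntroDep (X : Finset V) (y : V) :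
      Provable ((Formula.dep X y).imp (.box X (.dep X y)))
  /-- T: `𝖣_X φ → φ` -/
  | boxT (X : Finset V) (φ : Formula V ar) : Provable ((Formula.box X φ).imp φ)
  /-- 4: `𝖣_X φ → 𝖣_X 𝖣_X φ` -/
  | box4 (X : Finset V) (φ : Formula V ar) :
      Provable ((Formula.box X φ).imp (.box X (.box X φ)))
  /-- 5: `¬𝖣_X φ → 𝖣_X ¬𝖣_X φ` -/
  | box5 (X : Finset V) (φ : Formula V ar) :
      Provable ((Formula.neg (.box X φ)).imp (.box X (.neg (.box X φ))))
  /-- Necessitation: from `φ`, infer `𝖣_X φ` -/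
  | boxNec (X : Finset V) {φ : Formula V ar} (h : Provable φ) : Provable (.box X φ)
  /-- Dep-Ref: `D_X x` for `x ∈ X` -/
  | depRef (X : Finset V) (x : V) (h : x ∈ X) : Provable (.dep X x)
  /-- Dep-Trans: `D_X Y ∧ D_Y z → D_X z`, with `Y` the set of entries of `ys`. (As `D_X Z` is the
  conjunction of all `D_X z` with `z ∈ Z`, this is the scheme `D_X Y ∧ D_Y Z → D_X Z`.) -/
  | depTrans (X : Finset V) (ys : List V) (z : V) :
      Provable ((depAnd X ys (.dep ys.toFinset z)).imp (.dep X z))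
  /-- Transfer: `D_X Y ∧ 𝖣_Y φ → 𝖣_X φ`, with `Y` the set of entries of `ys` -/
  | transfer (X : Finset V) (ys : List V) (φ : Formula V ar) :
      Provable ((depAnd X ys (.box ys.toFinset φ)).imp (.box X φ))
  /-- Reflexivity of Identity: `x ≡ x` -/
  | identRefl (x : V) : Provable (.ident x x)
  /-- Substitution of Identicals: `x ≡ y → (φ → ψ)`, where `ψ` is obtained by substituting `y`
  for some occurrence of `x` in `φ` -/
  | identSubst (x y : V) {φ ψ : Formula V ar} (h : Replace x y φ ψ) :
      Provable ((Formula.ident x y).imp (φ.imp ψ))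

end ProofSystem

section Coding

variable {V : Type u} {Pred : Type v} {ar : Pred → ℕ} [Encodable V] [Encodable Pred]

/-- The Gödel number of a formula, relative to numberings of the variables and of the predicate
symbols: the form in which formulas are given to algorithms. -/
def Formula.code : Formula V ar → ℕ
  | .atom P x => Nat.pair 0 (Nat.pair (Encodable.encode P) (Encodable.encode (List.ofFn x)))
  | .ident x y => Nat.pair 1 (Nat.pair (Encodable.encode x) (Encodable.encode y))
  | .neg φ => Nat.pair 2 φ.code
  | .and φ ψ => Nat.pair 3 (Nat.pair φ.code ψ.code)
  | .box X φ => Nat.pair 4 (Nat.pair (Encodable.encode X) φ.code)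
  | .dep X y => Nat.pair 5 (Nat.pair (Encodable.encode X) (Encodable.encode y))

theorem Formula.code_injective :
    Function.Injective (Formula.code : Formula V ar → ℕ) := by
  intro φ
  induction φ with
  | atom P x =>
    intro ψ h
    cases ψ with
    | atom Q y =>
      simp only [Formula.code, Nat.pair_eq_pair, Encodable.encode_inj, true_and] at h
      obtain ⟨rfl, h⟩ := h
      rw [List.ofFn_injective h]
    | _ => simp [Formula.code, Nat.pair_eq_pair] at h
  | ident x y =>
    intro ψ h
    cases ψ <;> simp_all [Formula.code, Nat.pair_eq_pair]
  | neg φ ih =>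
    intro ψ h
    cases ψ with
    | neg ψ =>
      simp only [Formula.code, Nat.pair_eq_pair, true_and] at h
      rw [ih h]
    | _ => simp [Formula.code, Nat.pair_eq_pair] at h
  | and φ₁ φ₂ ih₁ ih₂ =>
    intro ψ h
    cases ψ with
    | and ψ₁ ψ₂ =>
      simp only [Formula.code, Nat.pair_eq_pair, true_and] at h
      rw [ih₁ h.1, ih₂ h.2]
    | _ => simp [Formula.code, Nat.pair_eq_pair] at h
  | box X φ ih =>
    intro ψ h
    cases ψ with
    | box Y ψ =>
      simp only [Formula.code, Nat.pair_eq_pair, Encodable.encode_inj, true_and] at h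
      rw [h.1, ih h.2]
    | _ => simp [Formula.code, Nat.pair_eq_pair] at h
  | dep X y =>
    intro ψ h
    cases ψ <;> simp_all [Formula.code, Nat.pair_eq_pair]

end Coding

end LFD

/-! Both claims reduce to quasi-models: families of types, each assigning truth values to a set `Φ`
of formulas that is closed under subformulas and contains all dependence and identity atoms. Every
false `𝖣_X φ` must have a witness type that refutes `φ` and agrees on whatever is settled by the
variables depending on `X`. The states of a model form a quasi-model (`quasiModel_states`), and so
do the maximal theories (`quasiModel_isTheory`).

Conversely, a quasi-model unravels into a tree of paths from a type `S₀`, each path being one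
admissible assignment. Along a step labelled `X`, a variable keeps its value if it depends on `X` at
the type being left; otherwise it receives a fresh value, tagged with the new path. Values also
carry the identity class of the variable at `S₀`, which is the same all over the tree. Two paths
that agree on `X` are then linked by steps that preserve `X`, so their end types agree on everything
settled by `X` (`Unravel.similar_of_agree`). This yields the truth lemma `Unravel.truth`.

For completeness, an unprovable formula is missing from some maximal theory. Restricting types to a
finite `Φ` (`QuasiModel.filtration`) leaves finitely many of them, and the unravelling refutes the
formula. For decidability, a formula is satisfiable exactly when it occurs in a type of a
quasi-model over finitely many formulas. Such a quasi-model is a pair of numbers read as bit sets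
and bounded computably, so a bounded search decides the question (`SatCodes`). -/

namespace LFD

/-! ### Quasi-models -/

section QuasiModel

variable {V : Type u} {Pred : Type v} {ar : Pred → ℕ}

/-- `φ` is an atom or a dependence quantification whose truth value is settled by the values of
the variables in `D`. -/
def Formula.DeterminedBy (D : Set V) : Formula V ar → Prop
  | .atom _ z => ∀ i, z i ∈ D
  | .ident _ _ => True
  | .neg _ => False
  | .and _ _ => False
  | .box X _ => ∀ x ∈ X, x ∈ D
  | .dep X _ => ∀ x ∈ X, x ∈ D

theorem Formula.DeterminedBy.mono {D E : Set V} (h : D ⊆ E) {χ : Formula V ar}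
    (hχ : χ.DeterminedBy D) : χ.DeterminedBy E := by
  cases χ <;> simp only [Formula.DeterminedBy] at * <;> aesop

/-- A set of formulas closed under subformulas and containing all dependence atoms and all identity
atoms. -/
structure IsClosedSet (Φ : Set (Formula V ar)) : Prop where
  neg {φ} (h : .neg φ ∈ Φ) : φ ∈ Φ
  andLeft {φ ψ} (h : .and φ ψ ∈ Φ) : φ ∈ Φ
  andRight {φ ψ} (h : .and φ ψ ∈ Φ) : ψ ∈ Φ
  box {X φ} (h : .box X φ ∈ Φ) : φ ∈ Φ
  dep (X y) : .dep X y ∈ Φ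
  ident (x y) : .ident x y ∈ Φ

/-- Types `S` and `S'` agree on all formulas of `Φ` that are settled by the variables on which `X`
locally depends according to `S`. -/
def Step (Φ : Set (Formula V ar)) {T : Type*} (val : T → Formula V ar → Prop) (X : Finset V)
    (S S' : T) : Prop :=
  ∀ χ ∈ Φ, χ.DeterminedBy {y | val S (.dep X y)} → (val S χ ↔ val S' χ)

/-- A quasi-model: a family of `Φ`-types, each given by its true formulas, with witnesses for the
dependence quantifiers. -/
structure QuasiModel (Φ : Set (Formula V ar)) {T : Type*} (val : T → Formula V ar → Prop) :
    Prop where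
  neg S {φ} (h : .neg φ ∈ Φ) : val S (.neg φ) ↔ ¬ val S φ
  and S {φ ψ} (h : .and φ ψ ∈ Φ) : val S (.and φ ψ) ↔ val S φ ∧ val S ψ
  boxT S {X φ} (h : .box X φ ∈ Φ) : val S (.box X φ) → val S φ
  depRefl S X x (h : x ∈ X) : val S (.dep X x)
  depTrans S X Y z : (∀ y ∈ Y, val S (.dep X y)) → val S (.dep Y z) → val S (.dep X z)
  identRefl S x : val S (.ident x x)
  identSymm S x y : val S (.ident x y) → val S (.ident y x)
  identTrans S x y z : val S (.ident x y) → val S (.ident y z) → val S (.ident x z)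
  identDep S X x y : val S (.ident x y) → val S (.dep X x) → val S (.dep X y)
  identAtom S {P z z'} (h : .atom P z ∈ Φ) (h' : .atom P z' ∈ Φ) :
    (∀ i, val S (.ident (z i) (z' i))) → val S (.atom P z) → val S (.atom P z')
  witness S {X φ} (h : .box X φ ∈ Φ) : ¬ val S (.box X φ) → ∃ S', Step Φ val X S S' ∧ ¬ val S' φ

/-! ### Unravelling a quasi-model into a dependence model -/

namespace Unravel

variable {T : Type*} (Φ : Set (Formula V ar)) (val : T → Formula V ar → Prop) (S₀ : T)

/-- The type at the end of a path that starts at the type `S₀`. -/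
def last : List (Finset V × T) → T
  | [] => S₀
  | p :: _ => p.2

/-- The paths that follow `Step`. -/
def IsPath : List (Finset V × T) → Prop
  | [] => True
  | p :: π => IsPath π ∧ Step Φ val p.1 (last S₀ π) p.2

/-- The variables identified with `y`. -/
def cls (y : V) : Set V := {x | val S₀ (.ident x y)}

open Classical in
/-- The value of `y` at a path: it is fresh unless the last step of the path preserves it. -/
noncomputable def value : List (Finset V × T) → V → Set V × List (Finset V × T)
  | [], y => (cls val S₀ y, [])
  | p :: π, y => if val (last S₀ π) (.dep p.1 y) then value π y else (cls val S₀ y, p :: π)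

/-- The unravelling of a quasi-model. -/
noncomputable def model : Model V ar where
  Obj := Set V × List (Finset V × T)
  interp P a := ∃ π, IsPath Φ val S₀ π ∧ ∃ z, .atom P z ∈ Φ ∧ val (last S₀ π) (.atom P z) ∧
    a = fun i => value val S₀ π (z i)
  states := {s | ∃ π, IsPath Φ val S₀ π ∧ s = value val S₀ π}

variable {Φ val S₀}

theorem value_fst (π : List (Finset V × T)) (y : V) :
    (value val S₀ π y).1 = cls val S₀ y := by
  induction π with
  | nil => rfl
  | cons p π ih => unfold value; split_ifs <;> simp [ih]

/-- The second component is the path at which the current value was created. Its length therefore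
detects freshness. -/
theorem value_snd_suffix (π : List (Finset V × T)) (y : V) :
    (value val S₀ π y).2 <:+ π := by
  induction π with
  | nil => exact List.suffix_rfl
  | cons p π ih =>
    unfold value
    split_ifs
    · exact ih.trans (List.suffix_cons p π)
    · exact List.suffix_rfl

theorem value_cons_of_dep {p : Finset V × T} {π : List (Finset V × T)} {y : V}
    (h : val (last S₀ π) (.dep p.1 y)) : value val S₀ (p :: π) y = value val S₀ π y := by
  rw [value, if_pos h]

theorem value_cons_of_not_dep {p : Finset V × T} {π : List (Finset V × T)} {y : V}
    (h : ¬ val (last S₀ π) (.dep p.1 y)) :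
    value val S₀ (p :: π) y = (cls val S₀ y, p :: π) := by
  rw [value, if_neg h]

/-- Identity atoms count as settled by every set of variables, so each step transports them
unchanged; this makes identity global in the tree. -/
theorem ident_iff (hΦ : IsClosedSet Φ) {π : List (Finset V × T)} (hπ : IsPath Φ val S₀ π)
    (x y : V) : val (last S₀ π) (.ident x y) ↔ val S₀ (.ident x y) := by
  induction π with
  | nil => rfl
  | cons p π ih => exact (hπ.2 _ (hΦ.ident x y) trivial).symm.trans (ih hπ.1)

theorem cls_eq_iff (hQ : QuasiModel Φ val) (x y : V) :
    cls val S₀ x = cls val S₀ y ↔ val S₀ (.ident x y) := by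
  constructor
  · intro h
    have : x ∈ cls val S₀ y := h ▸ hQ.identRefl S₀ x
    exact this
  · intro h
    ext z
    exact ⟨fun hz => hQ.identTrans _ _ _ _ hz h,
      fun hz => hQ.identTrans _ _ _ _ hz (hQ.identSymm _ _ _ h)⟩

/-- By `identDep`, identified variables are always kept or refreshed together, and fresh values
depend on the variable only through its class. -/
theorem value_eq_of_ident (hΦ : IsClosedSet Φ) (hQ : QuasiModel Φ val)
    {π : List (Finset V × T)} (hπ : IsPath Φ val S₀ π) {x y : V} (h : val S₀ (.ident x y)) :
    value val S₀ π x = value val S₀ π y := by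
  induction π with
  | nil => simp [value, (cls_eq_iff hQ x y).2 h]
  | cons p π ih =>
    have h' := (ident_iff hΦ hπ.1 x y).2 h
    have : val (last S₀ π) (.dep p.1 x) ↔ val (last S₀ π) (.dep p.1 y) :=
      ⟨hQ.identDep _ _ _ _ h', hQ.identDep _ _ _ _ (hQ.identSymm _ _ _ h')⟩
    by_cases hd : val (last S₀ π) (.dep p.1 x)
    · rw [value_cons_of_dep hd, value_cons_of_dep (this.1 hd), ih hπ.1]
    · rw [value_cons_of_not_dep hd, value_cons_of_not_dep (mt this.2 hd),
        (cls_eq_iff hQ x y).2 h]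

/-- The types at the ends of `π` and `π'` agree on what is settled by `X`, and so do the values of
the variables that depend on `X`. -/
def Similar (Φ : Set (Formula V ar)) (val : T → Formula V ar → Prop) (S₀ : T) (X : Finset V)
    (π π' : List (Finset V × T)) : Prop :=
  (∀ χ ∈ Φ, χ.DeterminedBy {y | y ∈ X} → (val (last S₀ π) χ ↔ val (last S₀ π') χ)) ∧
    ∀ y, val (last S₀ π) (.dep X y) → value val S₀ π y = value val S₀ π' y

theorem Similar.symm (hΦ : IsClosedSet Φ) {X : Finset V} {π π' : List (Finset V × T)}
    (h : Similar Φ val S₀ X π π') : Similar Φ val S₀ X π' π :=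
  ⟨fun χ hχ hd => (h.1 χ hχ hd).symm, fun y hy =>
    (h.2 y ((h.1 _ (hΦ.dep X y) (fun _ hx => hx)).2 hy)).symm⟩

/-- The inductive step for `similar_of_agree`: unless the paths coincide, the last step of the
longer one must have preserved all of `X`, so it can be removed without disturbing agreement or
anything settled by `X`. -/
theorem similar_of_agree_of_length_le (hΦ : IsClosedSet Φ) (hQ : QuasiModel Φ val) {X : Finset V}
    {π π' : List (Finset V × T)} (hπ : IsPath Φ val S₀ π)
    (h : Agree X (value val S₀ π) (value val S₀ π')) (hle : π'.length ≤ π.length)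
    (ih : ∀ p ρ, π = p :: ρ → Agree X (value val S₀ ρ) (value val S₀ π') →
      Similar Φ val S₀ X ρ π') : Similar Φ val S₀ X π π' := by
  by_cases heq : π = π'
  · subst heq
    exact ⟨fun _ _ _ => Iff.rfl, fun _ _ => rfl⟩
  cases π with
  | nil =>
    simp only [List.length_nil, Nat.le_zero, List.length_eq_zero_iff] at hle
    exact absurd hle.symm heq
  | cons p ρ =>
    -- A refreshed `x` would carry the tag `p :: ρ`. By agreement this tag is a suffix of `π'`,
    -- which is no longer than it, forcing the two paths to be equal.
    have key : ∀ x ∈ X, val (last S₀ ρ) (.dep p.1 x) := by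
      intro x hx
      by_contra hn
      have h1 := h x hx
      rw [value_cons_of_not_dep hn] at h1
      have h2 : (value val S₀ π' x).2 <:+ π' := value_snd_suffix π' x
      rw [← h1] at h2
      exact heq (h2.eq_of_length_le hle)
    have hs := ih p ρ rfl (fun x hx => by rw [← value_cons_of_dep (key x hx)]; exact h x hx)
    have hst : ∀ χ ∈ Φ, χ.DeterminedBy {y | y ∈ X} → (val (last S₀ ρ) χ ↔ val p.2 χ) :=
      fun χ hχ hd => hπ.2 χ hχ (hd.mono fun y hy => key y hy)
    refine ⟨fun χ hχ hd => (hst χ hχ hd).symm.trans (hs.1 χ hχ hd), fun y hy => ?_⟩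
    have hy' := (hst _ (hΦ.dep X y) (fun _ hx => hx)).2 hy
    -- All of `X` depends on `p.1` and `y` depends on `X`, so `y` was kept as well.
    rw [value_cons_of_dep (hQ.depTrans _ _ X _ key hy'), hs.2 y hy']

/-- Induction on the sum of the lengths, always shortening the longer path; symmetry of `Similar`
allows either path to play that role. -/
theorem similar_of_agree (hΦ : IsClosedSet Φ) (hQ : QuasiModel Φ val) {X : Finset V}
    {π π' : List (Finset V × T)} (hπ : IsPath Φ val S₀ π) (hπ' : IsPath Φ val S₀ π')
    (h : Agree X (value val S₀ π) (value val S₀ π')) : Similar Φ val S₀ X π π' := by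
  obtain ⟨n, hn⟩ : ∃ n, π.length + π'.length = n := ⟨_, rfl⟩
  induction n using Nat.strong_induction_on generalizing π π' with
  | _ n IH =>
    have hsymm : ∀ {ρ ρ' : List (Finset V × T)}, Agree X (value val S₀ ρ) (value val S₀ ρ') →
        Agree X (value val S₀ ρ') (value val S₀ ρ) := fun h x hx => (h x hx).symm
    rcases le_total π'.length π.length with hle | hle
    · refine similar_of_agree_of_length_le hΦ hQ hπ h hle ?_
      rintro p ρ rfl hag
      exact IH _ (by simp only [List.length_cons] at hn; omega) hπ.1 hπ' hag rfl
    · refine (similar_of_agree_of_length_le hΦ hQ hπ' (hsymm h) hle ?_).symm hΦ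
      rintro p ρ rfl hag
      exact IH _ (by simp only [List.length_cons] at hn; omega) hπ'.1 hπ hag rfl

/-- The one-step extension of a path by a step along `X` keeps the values of `X`. -/
theorem agree_cons (hQ : QuasiModel Φ val) (X : Finset V) (S : T) (π : List (Finset V × T)) :
    Agree X (value val S₀ π) (value val S₀ ((X, S) :: π)) := fun x hx =>
  (value_cons_of_dep (p := (X, S)) (hQ.depRefl _ X x hx)).symm

theorem truth (hΦ : IsClosedSet Φ) (hQ : QuasiModel Φ val) {φ : Formula V ar} (hφ : φ ∈ Φ)
    {π : List (Finset V × T)} (hπ : IsPath Φ val S₀ π) :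
    Holds (model Φ val S₀) (value val S₀ π) φ ↔ val (last S₀ π) φ := by
  induction φ generalizing π with
  | atom P z =>
    constructor
    -- The tuple may have entered the interpretation through another path and other variables.
    -- Comparing first components shows that `z'` and `z` are identified, which moves the atom to
    -- `z` at `π'`; similarity then moves it to `π`.
    · rintro ⟨π', hπ', z', hz', hval, heq⟩
      have hid : ∀ i, val S₀ (.ident (z' i) (z i)) := fun i => by
        have := congrArg Prod.fst (congrFun heq i)
        simp only [value_fst] at this
        exact (cls_eq_iff hQ _ _).1 this.symm
      have h1 : val (last S₀ π') (.atom P z) :=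
        hQ.identAtom _ hz' hφ (fun i => (ident_iff hΦ hπ' _ _).2 (hid i)) hval
      classical
      have hag : Agree (Finset.univ.image z) (value val S₀ π) (value val S₀ π') := by
        intro x hx
        obtain ⟨i, -, rfl⟩ := Finset.mem_image.1 hx
        rw [← value_eq_of_ident hΦ hQ hπ' (hid i)]
        exact congrFun heq i
      exact ((similar_of_agree hΦ hQ hπ hπ' hag).1 _ hφ
        (fun i => Finset.mem_image_of_mem z (Finset.mem_univ i))).2 h1
    · intro h
      exact ⟨π, hπ, z, hφ, h, rfl⟩
  | ident x y =>
    rw [ident_iff hΦ hπ]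
    constructor
    · intro h
      have := h _ ⟨[], trivial, rfl⟩
      exact (cls_eq_iff hQ x y).1 (congrArg Prod.fst this)
    · rintro h _ ⟨π', hπ', rfl⟩
      exact value_eq_of_ident hΦ hQ hπ' h
  | neg φ ih => rw [hQ.neg _ hφ, ← ih (hΦ.neg hφ) hπ]; rfl
  | and φ ψ ih₁ ih₂ =>
    rw [hQ.and _ hφ, ← ih₁ (hΦ.andLeft hφ) hπ, ← ih₂ (hΦ.andRight hφ) hπ]; rfl
  | box X φ ih =>
    constructor
    · intro h
      by_contra hn
      obtain ⟨S, hS, hnφ⟩ := hQ.witness _ hφ hn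
      have hp : IsPath Φ val S₀ ((X, S) :: π) := ⟨hπ, hS⟩
      exact hnφ ((ih (hΦ.box hφ) hp).1 (h _ ⟨_, hp, rfl⟩ (agree_cons hQ X S π)))
    · rintro h _ ⟨π', hπ', rfl⟩ hag
      exact (ih (hΦ.box hφ) hπ').2 (hQ.boxT _ hφ
        (((similar_of_agree hΦ hQ hπ hπ' hag).1 _ hφ (fun _ hx => hx)).1 h))
  | dep X y =>
    constructor
    · intro h
      by_contra hn
      -- An idle step to the same type keeps `X` but refreshes `y`, and the new tag is too long to
      -- be the old value.
      have hp : IsPath Φ val S₀ ((X, last S₀ π) :: π) := ⟨hπ, fun _ _ _ => Iff.rfl⟩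
      have heq := h _ ⟨_, hp, rfl⟩ (agree_cons hQ X _ π)
      rw [value_cons_of_not_dep hn] at heq
      have hle := (value_snd_suffix (val := val) (S₀ := S₀) π y).length_le
      rw [heq] at hle
      simp at hle
    · rintro h _ ⟨π', hπ', rfl⟩ hag
      exact (similar_of_agree hΦ hQ hπ hπ' hag).2 y h

end Unravel

/-! ### Passing between models and quasi-models; finite closed sets -/

/-- The image of a model under a map of its objects. -/
def Model.map (M : Model V ar) {O : Type*} (f : M.Obj → O) : Model V ar where
  Obj := O
  interp P a := ∃ b, M.interp P b ∧ a = fun i => f (b i)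
  states := {s | ∃ t ∈ M.states, s = fun x => f (t x)}

theorem Model.holds_map (M : Model V ar) {O : Type*} {f : M.Obj → O} (hf : Function.Injective f)
    (φ : Formula V ar) (s : V → M.Obj) : Holds (M.map f) (fun x => f (s x)) φ ↔ Holds M s φ := by
  have hag : ∀ (X : Finset V) (s t : V → M.Obj),
      Agree X (fun x => f (s x)) (fun x => f (t x)) ↔ Agree X s t := fun X s t => by
    simp only [Agree, hf.eq_iff]
  induction φ generalizing s with
  | atom P z =>
    constructor
    · rintro ⟨b, hb, heq⟩
      have : (fun i => s (z i)) = b := funext fun i => hf (congrFun heq i)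
      simpa only [Holds, this] using hb
    · intro h
      exact ⟨_, h, rfl⟩
  | ident x y =>
    constructor
    · intro h t ht
      exact hf (h _ ⟨t, ht, rfl⟩)
    · rintro h _ ⟨t, ht, rfl⟩
      exact congrArg f (h t ht)
  | neg φ ih => exact not_congr (ih s)
  | and φ ψ ih₁ ih₂ => exact and_congr (ih₁ s) (ih₂ s)
  | box X φ ih =>
    constructor
    · intro h t ht hst
      exact (ih t).1 (h _ ⟨t, ht, rfl⟩ ((hag X s t).2 hst))
    · rintro h _ ⟨t, ht, rfl⟩ hst
      exact (ih t).2 (h t ht ((hag X s t).1 hst))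
  | dep X y =>
    constructor
    · intro h t ht hst
      exact hf (h _ ⟨t, ht, rfl⟩ ((hag X s t).2 hst))
    · rintro h _ ⟨t, ht, rfl⟩ hst
      exact congrArg f (h t ht ((hag X s t).1 hst))

/-- A quasi-model with countably many types yields a model of each of its types. -/
theorem QuasiModel.exists_model [Finite V] {T : Type*} [Countable T] {Φ : Set (Formula V ar)}
    {val : T → Formula V ar → Prop} (hΦ : IsClosedSet Φ) (hQ : QuasiModel Φ val) (S : T) :
    ∃ M : Model.{u, v, w} V ar, ∃ s ∈ M.states, ∀ φ ∈ Φ, Holds M s φ ↔ val S φ := by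
  have : Countable (Unravel.model Φ val S).Obj :=
    inferInstanceAs (Countable (Set V × List (Finset V × T)))
  -- The objects of the unravelling live in a universe fixed by `V` and `T`. Countability lets them
  -- be renamed as lifted natural numbers, available in every universe `w`.
  obtain ⟨f, hf⟩ := exists_injective_nat (Unravel.model Φ val S).Obj
  have hf' : Function.Injective fun a => ULift.up.{w} (f a) := fun a b h => hf (ULift.up_injective h)
  refine ⟨(Unravel.model Φ val S).map fun a => ULift.up.{w} (f a), _,
    ⟨_, ⟨[], trivial, rfl⟩, rfl⟩, fun φ hφ => ?_⟩
  exact (Model.holds_map _ hf' φ _).trans (Unravel.truth hΦ hQ hφ trivial)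

/-- The states of a model form a quasi-model. -/
theorem quasiModel_states (M : Model.{u, v, w} V ar) (Φ : Set (Formula V ar)) :
    QuasiModel Φ fun (s : M.states) φ => Holds M s φ where
  neg _ _ _ := Iff.rfl
  and _ _ _ _ := Iff.rfl
  boxT S _ _ _ h := h S S.2 fun _ _ => rfl
  depRefl _ _ x hx _ _ hag := hag x hx
  depTrans _ _ _ _ hY hz t ht hag := hz t ht fun y hy => hY y hy t ht hag
  identRefl _ _ _ _ := rfl
  identSymm _ _ _ h t ht := (h t ht).symm
  identTrans _ _ _ _ h h' t ht := (h t ht).trans (h' t ht)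
  identDep S _ _ _ h h' t ht hag := by rw [← h t ht, ← h S S.2]; exact h' t ht hag
  identAtom S P z z' _ _ h h' := by
    have : (fun i => S.1 (z i)) = fun i => S.1 (z' i) := funext fun i => h i S S.2
    simpa only [Holds, this] using h'
  witness S X φ _ h := by
    simp only [Holds, not_forall] at h
    obtain ⟨t, ht, hag, hn⟩ := h
    refine ⟨⟨t, ht⟩, fun χ _ hχ => ?_, hn⟩
    -- The state `t` agrees with `S` on `X`, hence on all variables that depend on `X` at `S`.
    have key : ∀ Y : Finset V, (∀ y ∈ Y, Holds M S (.dep X y)) → Agree Y S.1 t :=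
      fun Y hY y hy => hY y hy t ht hag
    cases χ with
    | atom P z =>
      have : (fun i => S.1 (z i)) = fun i => t (z i) := funext fun i => hχ i t ht hag
      simp only [Holds, this]
    | ident x y => exact Iff.rfl
    | neg χ => exact hχ.elim
    | and χ χ' => exact hχ.elim
    | box Y χ =>
      have hY := key Y hχ
      exact ⟨fun h r hr hag' => h r hr fun y hy => (hY y hy).trans (hag' y hy),
        fun h r hr hag' => h r hr fun y hy => (hY y hy).symm.trans (hag' y hy)⟩
    | dep Y y =>
      have hY := key Y hχ
      constructor
      · intro h r hr hag'
        exact (h t ht hY).symm.trans (h r hr fun y hy => (hY y hy).trans (hag' y hy))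
      · intro h r hr hag'
        exact (h S S.2 fun y hy => (hY y hy).symm).symm.trans
          (h r hr fun y hy => (hY y hy).symm.trans (hag' y hy))

/-- Types that agree on `Φ` may be identified. -/
theorem QuasiModel.filtration {Φ : Set (Formula V ar)} (hΦ : IsClosedSet Φ) {T : Type*}
    {val : T → Formula V ar → Prop} (hQ : QuasiModel Φ val) :
    QuasiModel Φ fun (S : Set.range fun t => {χ | χ ∈ Φ ∧ val t χ}) χ => χ ∈ S.1 where
  neg := by
    rintro ⟨_, t, rfl⟩ φ h
    simp only [Set.mem_ofPred_eq, h, hΦ.neg h, true_and, hQ.neg t h]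
  and := by
    rintro ⟨_, t, rfl⟩ φ ψ h
    simp only [Set.mem_ofPred_eq, h, hΦ.andLeft h, hΦ.andRight h, true_and, hQ.and t h]
  boxT := by
    rintro ⟨_, t, rfl⟩ X φ h ⟨-, h'⟩
    exact ⟨hΦ.box h, hQ.boxT t h h'⟩
  depRefl := by
    rintro ⟨_, t, rfl⟩ X x hx
    exact ⟨hΦ.dep X x, hQ.depRefl t X x hx⟩
  depTrans := by
    rintro ⟨_, t, rfl⟩ X Y z hY ⟨-, hz⟩
    exact ⟨hΦ.dep X z, hQ.depTrans t X Y z (fun y hy => (hY y hy).2) hz⟩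
  identRefl := by
    rintro ⟨_, t, rfl⟩ x
    exact ⟨hΦ.ident x x, hQ.identRefl t x⟩
  identSymm := by
    rintro ⟨_, t, rfl⟩ x y ⟨-, h⟩
    exact ⟨hΦ.ident y x, hQ.identSymm t x y h⟩
  identTrans := by
    rintro ⟨_, t, rfl⟩ x y z ⟨-, h⟩ ⟨-, h'⟩
    exact ⟨hΦ.ident x z, hQ.identTrans t x y z h h'⟩
  identDep := by
    rintro ⟨_, t, rfl⟩ X x y ⟨-, h⟩ ⟨-, h'⟩
    exact ⟨hΦ.dep X y, hQ.identDep t X x y h h'⟩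
  identAtom := by
    rintro ⟨_, t, rfl⟩ P z z' h h' hi ⟨-, hz⟩
    exact ⟨h', hQ.identAtom t h h' (fun i => (hi i).2) hz⟩
  witness := by
    rintro ⟨_, t, rfl⟩ X φ h hn
    obtain ⟨t', hst, hn'⟩ := hQ.witness t h fun h' => hn ⟨h, h'⟩
    refine ⟨⟨_, t', rfl⟩, fun χ hχ hd => and_congr_right fun _ => hst χ hχ ?_, fun h' => hn' h'.2⟩
    exact hd.mono fun y hy => hy.2

theorem IsClosedSet.union {Φ Ψ : Set (Formula V ar)} (hΦ : IsClosedSet Φ) (hΨ : IsClosedSet Ψ) :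
    IsClosedSet (Φ ∪ Ψ) where
  neg h := h.imp hΦ.neg hΨ.neg
  andLeft h := h.imp hΦ.andLeft hΨ.andLeft
  andRight h := h.imp hΦ.andRight hΨ.andRight
  box h := h.imp hΦ.box hΨ.box
  dep X y := .inl (hΦ.dep X y)
  ident x y := .inl (hΦ.ident x y)

theorem IsClosedSet.insert {Φ : Set (Formula V ar)} (hΦ : IsClosedSet Φ) {φ : Formula V ar}
    (hneg : ∀ ψ, φ = .neg ψ → ψ ∈ Φ) (hand : ∀ ψ χ, φ = .and ψ χ → ψ ∈ Φ ∧ χ ∈ Φ)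
    (hbox : ∀ X ψ, φ = .box X ψ → ψ ∈ Φ) : IsClosedSet (insert φ Φ) where
  neg h := .inr (h.elim (fun h => hneg _ h.symm) hΦ.neg)
  andLeft h := .inr (h.elim (fun h => (hand _ _ h.symm).1) hΦ.andLeft)
  andRight h := .inr (h.elim (fun h => (hand _ _ h.symm).2) hΦ.andRight)
  box h := .inr (h.elim (fun h => hbox _ _ h.symm) hΦ.box)
  dep X y := .inr (hΦ.dep X y)
  ident x y := .inr (hΦ.ident x y)

/-- Finiteness of `V` leaves only finitely many dependence and identity atoms to add to the
subformulas. -/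
theorem exists_finite_isClosedSet [Finite V] (φ : Formula V ar) :
    ∃ Φ : Set (Formula V ar), Φ.Finite ∧ IsClosedSet Φ ∧ φ ∈ Φ := by
  have base : ∃ Φ : Set (Formula V ar), Φ.Finite ∧ IsClosedSet Φ := by
    refine ⟨(Set.range fun p : Finset V × V => .dep p.1 p.2) ∪
      Set.range fun p : V × V => .ident p.1 p.2, (Set.finite_range _).union (Set.finite_range _), ?_⟩
    constructor <;> simp
  obtain ⟨Ψ, hfin, hcl⟩ := base
  have base_insert : ∀ φ : Formula V ar, (∀ ψ, φ ≠ .neg ψ) → (∀ ψ χ, φ ≠ .and ψ χ) →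
      (∀ X ψ, φ ≠ .box X ψ) → ∃ Φ : Set (Formula V ar), Φ.Finite ∧ IsClosedSet Φ ∧ φ ∈ Φ :=
    fun φ h₁ h₂ h₃ => ⟨insert φ Ψ, hfin.insert φ, hcl.insert (fun ψ h => absurd h (h₁ ψ))
      (fun ψ χ h => absurd h (h₂ ψ χ)) (fun X ψ h => absurd h (h₃ X ψ)), .inl rfl⟩
  induction φ with
  | atom P z => exact base_insert _ (by simp) (by simp) (by simp)
  | ident x y => exact base_insert _ (by simp) (by simp) (by simp)
  | dep X y => exact base_insert _ (by simp) (by simp) (by simp)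
  | neg φ ih =>
    obtain ⟨Φ, hfin, hcl, hφ⟩ := ih
    exact ⟨insert (.neg φ) Φ, hfin.insert _, hcl.insert (by simpa) (by simp) (by simp), .inl rfl⟩
  | and φ ψ ih₁ ih₂ =>
    obtain ⟨Φ₁, hfin₁, hcl₁, hφ₁⟩ := ih₁
    obtain ⟨Φ₂, hfin₂, hcl₂, hφ₂⟩ := ih₂
    refine ⟨insert (.and φ ψ) (Φ₁ ∪ Φ₂), (hfin₁.union hfin₂).insert _,
      (hcl₁.union hcl₂).insert (by simp) ?_ (by simp), .inl rfl⟩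
    rintro _ _ ⟨⟩
    exact ⟨.inl hφ₁, .inr hφ₂⟩
  | box X φ ih =>
    obtain ⟨Φ, hfin, hcl, hφ⟩ := ih
    refine ⟨insert (.box X φ) Φ, hfin.insert _, hcl.insert (by simp) (by simp) ?_, .inl rfl⟩
    rintro _ _ ⟨⟩
    exact hφ

end QuasiModel

end LFD

namespace LFD

/-! ### Soundness, and completeness by the canonical quasi-model -/

section Completeness

variable {V : Type u} {Pred : Type v} {ar : Pred → ℕ}

theorem holds_imp {M : Model.{u, v, w} V ar} {s : V → M.Obj} {φ ψ : Formula V ar} :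
    Holds M s (φ.imp ψ) ↔ (Holds M s φ → Holds M s ψ) := by
  simp only [Formula.imp, Holds, not_and, not_not]

theorem holds_depAnd {M : Model.{u, v, w} V ar} {s : V → M.Obj} {X : Finset V} {ys : List V}
    {ψ : Formula V ar} :
    Holds M s (depAnd X ys ψ) ↔ (∀ y ∈ ys, Holds M s (.dep X y)) ∧ Holds M s ψ := by
  induction ys with
  | nil => simp [depAnd]
  | cons y ys ih =>
    rw [List.forall_mem_cons, and_assoc, ← ih]
    rfl

variable [DecidableEq V]

/-- Since `x` and `y` coincide at all states, replacement is sound also under dependence quantifiers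
and inside their index sets. -/
theorem Replace.holds_iff {M : Model.{u, v, w} V ar} {x y : V} (hxy : ∀ t ∈ M.states, t x = t y)
    {φ ψ : Formula V ar} (h : Replace x y φ ψ) :
    ∀ s ∈ M.states, Holds M s φ ↔ Holds M s ψ := by
  have hag : ∀ X : Finset V, x ∈ X → ∀ s ∈ M.states, ∀ t ∈ M.states,
      Agree (replaceIn x y X) s t ↔ Agree X s t := by
    intro X hx s hs t ht
    simp only [Agree, replaceIn, Finset.mem_insert, Finset.mem_erase, forall_eq_or_imp]
    constructor
    · rintro ⟨hy, h⟩ z hz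
      by_cases hzx : z = x
      · rw [hzx, hxy s hs, hxy t ht, hy]
      · exact h z ⟨hzx, hz⟩
    · intro h
      exact ⟨by rw [← hxy s hs, ← hxy t ht, h x hx], fun z hz => h z hz.2⟩
  induction h with
  | atom P z i hi =>
    intro s hs
    have : (fun j => s (z j)) = fun j => s (Function.update z i y j) := by
      funext j
      by_cases hj : j = i
      · rw [hj, Function.update_self, hi, hxy s hs]
      · rw [Function.update_of_ne hj]
    simp only [Holds, this]
  | identLeft z => exact fun s hs => forall₂_congr fun t ht => by rw [hxy t ht]
  | identRight z => exact fun s hs => forall₂_congr fun t ht => by rw [hxy t ht]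
  | neg _ ih => exact fun s hs => not_congr (ih s hs)
  | andLeft χ _ ih => exact fun s hs => and_congr (ih s hs) Iff.rfl
  | andRight χ _ ih => exact fun s hs => and_congr Iff.rfl (ih s hs)
  | boxSet X φ hx => exact fun s hs => forall₂_congr fun t ht => by rw [hag X hx s hs t ht]
  | boxBody X _ ih =>
    exact fun s hs => forall₂_congr fun t ht => forall_congr' fun _ => ih t ht
  | depSet X z hx => exact fun s hs => forall₂_congr fun t ht => by rw [hag X hx s hs t ht]
  | depVar X => exact fun s hs => forall₂_congr fun t ht => by rw [hxy t ht, hxy s hs]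

/-- Soundness of the proof system. -/
theorem Provable.valid {φ : Formula V ar} (h : Provable φ) : Valid.{u, v, w} φ := by
  intro M
  induction h with
  | taut h => exact fun s _ => h (Holds M s) (fun _ => Iff.rfl) fun _ _ => Iff.rfl
  | modusPonens _ _ ih₁ ih₂ => exact fun s hs => holds_imp.1 (ih₁ s hs) (ih₂ s hs)
  | boxDist X φ ψ =>
    exact fun s _ => holds_imp.2 fun h => holds_imp.2 fun h' t ht hag =>
      holds_imp.1 (h t ht hag) (h' t ht hag)
  | boxIntroAtom P x =>
    refine fun s _ => holds_imp.2 fun h t _ hag => ?_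
    have : (fun i => s (x i)) = fun i => t (x i) :=
      funext fun i => hag _ (Finset.mem_image_of_mem x (Finset.mem_univ i))
    simpa only [Holds, this] using h
  | boxIntroDep X y =>
    refine fun s _ => holds_imp.2 fun h t ht hag r hr hag' => ?_
    exact (h t ht hag).symm.trans (h r hr fun x hx => (hag x hx).trans (hag' x hx))
  | boxT X φ => exact fun s hs => holds_imp.2 fun h => h s hs fun _ _ => rfl
  | box4 X φ =>
    exact fun s _ => holds_imp.2 fun h t _ hag r hr hag' =>
      h r hr fun x hx => (hag x hx).trans (hag' x hx)
  | box5 X φ =>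
    exact fun s _ => holds_imp.2 fun h t _ hag h' =>
      h fun r hr hag' => h' r hr fun x hx => (hag x hx).symm.trans (hag' x hx)
  | boxNec X _ ih => exact fun s _ t ht _ => ih t ht
  | depRef X x hx => exact fun s _ t _ hag => hag x hx
  | depTrans X ys z =>
    refine fun s _ => holds_imp.2 fun h t ht hag => ?_
    obtain ⟨h, h'⟩ := holds_depAnd.1 h
    exact h' t ht fun y hy => h y (List.mem_toFinset.1 hy) t ht hag
  | transfer X ys φ =>
    refine fun s _ => holds_imp.2 fun h t ht hag => ?_
    obtain ⟨h, h'⟩ := holds_depAnd.1 h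
    exact h' t ht fun y hy => h y (List.mem_toFinset.1 hy) t ht hag
  | identRefl x => exact fun s _ t _ => rfl
  | identSubst x y hr =>
    exact fun s hs => holds_imp.2 fun h => holds_imp.2 (hr.holds_iff h s hs).1

/-! ### Maximal theories -/

/-- Derivability from premises, with modus ponens as the only rule. -/
inductive Deriv (Γ : Set (Formula V ar)) : Formula V ar → Prop
  | premise {φ} (h : φ ∈ Γ) : Deriv Γ φ
  | thm {φ} (h : Provable φ) : Deriv Γ φ
  | mp {φ ψ} (h₁ : Deriv Γ (φ.imp ψ)) (h₂ : Deriv Γ φ) : Deriv Γ ψ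

theorem Deriv.taut_mp {Γ : Set (Formula V ar)} {φ ψ : Formula V ar} (h : Deriv Γ φ)
    (ht : Tautology (φ.imp ψ)) : Deriv Γ ψ := .mp (.thm (.taut ht)) h

theorem Deriv.taut_mp₂ {Γ : Set (Formula V ar)} {φ ψ χ : Formula V ar} (h : Deriv Γ φ)
    (h' : Deriv Γ ψ) (ht : Tautology (φ.imp (ψ.imp χ))) : Deriv Γ χ := .mp (h.taut_mp ht) h'

theorem Deriv.provable {φ : Formula V ar} (h : Deriv ∅ φ) : Provable φ := by
  induction h with
  | premise h => exact h.elim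
  | thm h => exact h
  | mp _ _ ih₁ ih₂ => exact .modusPonens ih₁ ih₂

theorem Deriv.mono {Γ Δ : Set (Formula V ar)} (hs : Γ ⊆ Δ) {φ : Formula V ar} (h : Deriv Γ φ) :
    Deriv Δ φ := by
  induction h with
  | premise h => exact .premise (hs h)
  | thm h => exact .thm h
  | mp _ _ ih₁ ih₂ => exact .mp ih₁ ih₂

theorem Deriv.deduction {Γ : Set (Formula V ar)} {φ ψ : Formula V ar}
    (h : Deriv (insert φ Γ) ψ) : Deriv Γ (φ.imp ψ) := by
  have weaken : ∀ {χ}, Deriv Γ χ → Deriv Γ (φ.imp χ) := fun h => h.taut_mp fun val hn ha => by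
    simp only [Formula.imp, hn, ha]; tauto
  induction h with
  | premise h =>
    rcases h with rfl | h
    · exact .thm (.taut fun val hn ha => by simp only [Formula.imp, hn, ha]; tauto)
    · exact weaken (.premise h)
  | thm h => exact weaken (.thm h)
  | mp _ _ ih₁ ih₂ =>
    exact ih₁.taut_mp₂ ih₂ fun val hn ha => by simp only [Formula.imp, hn, ha]; tauto

/-- Compactness of derivations, as needed for the upper bounds in Zorn's lemma. -/
theorem Deriv.exists_of_sUnion {c : Set (Set (Formula V ar))} (hc : IsChain (· ⊆ ·) c)
    (hne : c.Nonempty) {φ : Formula V ar} (h : Deriv (⋃₀ c) φ) : ∃ Γ ∈ c, Deriv Γ φ := by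
  induction h with
  | premise h =>
    obtain ⟨Γ, hΓ, h⟩ := h
    exact ⟨Γ, hΓ, .premise h⟩
  | thm h => exact ⟨_, hne.some_mem, .thm h⟩
  | mp _ _ ih₁ ih₂ =>
    obtain ⟨Γ₁, hΓ₁, h₁⟩ := ih₁
    obtain ⟨Γ₂, hΓ₂, h₂⟩ := ih₂
    rcases hc.total hΓ₁ hΓ₂ with hs | hs
    · exact ⟨Γ₂, hΓ₂, .mp (h₁.mono hs) h₂⟩
    · exact ⟨Γ₁, hΓ₁, .mp h₁ (h₂.mono hs)⟩

/-- Complete and consistent sets of formulas. -/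
structure IsTheory (Γ : Set (Formula V ar)) : Prop where
  mem_of_deriv {φ} (h : Deriv Γ φ) : φ ∈ Γ
  neg_mem_iff (φ) : Formula.neg φ ∈ Γ ↔ φ ∉ Γ

/-- Lindenbaum's lemma. -/
theorem exists_isTheory {Γ : Set (Formula V ar)} {φ : Formula V ar} (h : ¬ Deriv Γ φ) :
    ∃ Δ, Γ ⊆ Δ ∧ IsTheory Δ ∧ φ ∉ Δ := by
  obtain ⟨Δ, hs, hmax⟩ := zorn_subset_nonempty {Δ : Set (Formula V ar) | ¬ Deriv Δ φ}
    (fun c hc hchain hne => ⟨⋃₀ c, fun hd => by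
      obtain ⟨Δ, hΔ, hd⟩ := hd.exists_of_sUnion hchain hne
      exact hc hΔ hd, fun Δ hΔ => Set.subset_sUnion_of_mem hΔ⟩) Γ h
  have hcons : ∀ {ψ}, ψ ∉ Δ → Deriv Δ (ψ.imp φ) := by
    intro ψ hψ
    refine Deriv.deduction ?_
    by_contra hn
    exact hψ (hmax.le_of_ge hn (Set.subset_insert ψ Δ) (Set.mem_insert ψ Δ))
  have hclosed : ∀ {ψ}, Deriv Δ ψ → ψ ∈ Δ := by
    intro ψ hd
    by_contra hψ
    exact hmax.prop (.mp (hcons hψ) hd)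
  refine ⟨Δ, hs, ⟨hclosed, fun ψ => ⟨fun hn hψ => ?_, fun hψ => ?_⟩⟩,
    fun hφ => hmax.prop (.premise hφ)⟩
  · exact hmax.prop ((Deriv.premise hn).taut_mp₂ (.premise hψ) fun val hn ha => by
      simp only [Formula.imp, hn, ha]; tauto)
  · by_contra hn
    exact hmax.prop ((hcons hψ).taut_mp₂ (hcons hn) fun val hn ha => by
      simp only [Formula.imp, hn, ha]; tauto)

namespace IsTheory

variable {Γ : Set (Formula V ar)}

theorem mem_of_provable (hΓ : IsTheory Γ) {φ : Formula V ar} (h : Provable φ) : φ ∈ Γ :=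
  hΓ.mem_of_deriv (.thm h)

theorem mp (hΓ : IsTheory Γ) {φ ψ : Formula V ar} (h : Provable (φ.imp ψ)) (hφ : φ ∈ Γ) : ψ ∈ Γ :=
  hΓ.mem_of_deriv (.mp (.thm h) (.premise hφ))

theorem mp_mem (hΓ : IsTheory Γ) {φ ψ : Formula V ar} (h : φ.imp ψ ∈ Γ) (hφ : φ ∈ Γ) : ψ ∈ Γ :=
  hΓ.mem_of_deriv (.mp (.premise h) (.premise hφ))

theorem and_mem_iff (hΓ : IsTheory Γ) (φ ψ : Formula V ar) :
    Formula.and φ ψ ∈ Γ ↔ φ ∈ Γ ∧ ψ ∈ Γ :=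
  ⟨fun h => ⟨hΓ.mp (.taut fun val hn ha => by simp only [Formula.imp, hn, ha]; tauto) h,
    hΓ.mp (.taut fun val hn ha => by simp only [Formula.imp, hn, ha]; tauto) h⟩,
   fun h => hΓ.mem_of_deriv ((Deriv.premise h.1).taut_mp₂ (.premise h.2) fun val hn ha => by
    simp only [Formula.imp, hn, ha]; tauto)⟩

theorem depAnd_mem (hΓ : IsTheory Γ) {X : Finset V} {ys : List V} {ψ : Formula V ar}
    (hys : ∀ y ∈ ys, .dep X y ∈ Γ) (hψ : ψ ∈ Γ) : depAnd X ys ψ ∈ Γ := by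
  induction ys with
  | nil => exact hψ
  | cons y ys ih =>
    rw [List.forall_mem_cons] at hys
    exact (hΓ.and_mem_iff _ _).2 ⟨hys.1, ih hys.2⟩

theorem dep_trans (hΓ : IsTheory Γ) {X Y : Finset V} {z : V} (hY : ∀ y ∈ Y, .dep X y ∈ Γ)
    (hz : .dep Y z ∈ Γ) : .dep X z ∈ Γ := by
  have h := Provable.depTrans (ar := ar) X Y.toList z
  rw [Finset.toList_toFinset] at h
  exact hΓ.mp h (hΓ.depAnd_mem (fun y hy => hY y (Finset.mem_toList.1 hy)) hz)

theorem box_transfer (hΓ : IsTheory Γ) {X Y : Finset V} {φ : Formula V ar}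
    (hY : ∀ y ∈ Y, .dep X y ∈ Γ) (h : .box Y φ ∈ Γ) : .box X φ ∈ Γ := by
  have h' := Provable.transfer X Y.toList φ
  rw [Finset.toList_toFinset] at h'
  exact hΓ.mp h' (hΓ.depAnd_mem (fun y hy => hY y (Finset.mem_toList.1 hy)) h)

theorem subst (hΓ : IsTheory Γ) {x y : V} (hxy : .ident x y ∈ Γ) {φ ψ : Formula V ar}
    (h : Replace x y φ ψ) (hφ : φ ∈ Γ) : ψ ∈ Γ :=
  hΓ.mp_mem (hΓ.mp (.identSubst x y h) hxy) hφ

theorem ident_symm (hΓ : IsTheory Γ) {x y : V} (hxy : .ident x y ∈ Γ) : .ident y x ∈ Γ :=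
  hΓ.subst hxy (.identLeft x) (hΓ.mem_of_provable (.identRefl x))

/-- The axiom replaces one occurrence at a time, so the positions are changed one by one. -/
theorem atom_subst (hΓ : IsTheory Γ) {P : Pred} {z z' : Fin (ar P) → V}
    (h : ∀ i, .ident (z i) (z' i) ∈ Γ) (hz : .atom P z ∈ Γ) : .atom P z' ∈ Γ := by
  have key : ∀ I : Finset (Fin (ar P)), .atom P (I.piecewise z' z) ∈ Γ := by
    intro I
    induction I using Finset.induction_on with
    | empty => rwa [Finset.piecewise_empty]
    | insert i I hi ih =>
      rw [Finset.piecewise_insert]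
      exact hΓ.subst (h i) (.atom P _ i (Finset.piecewise_eq_of_notMem _ _ _ hi)) ih
  simpa using key Finset.univ

/-- The formulas that follow from the boxed members of a theory are themselves boxed members. -/
theorem box_mem_of_deriv (hΓ : IsTheory Γ) {X : Finset V} {φ : Formula V ar}
    (h : Deriv {χ | .box X χ ∈ Γ} φ) : .box X φ ∈ Γ := by
  induction h with
  | premise h => exact h
  | thm h => exact hΓ.mem_of_provable (.boxNec X h)
  | mp _ _ ih₁ ih₂ => exact hΓ.mp_mem (hΓ.mp (.boxDist X _ _) ih₁) ih₂

theorem box_mono (hΓ : IsTheory Γ) {X : Finset V} {φ ψ : Formula V ar} (h : Provable (φ.imp ψ))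
    (hφ : .box X φ ∈ Γ) : .box X ψ ∈ Γ :=
  hΓ.box_mem_of_deriv (.mp (.thm h) (.premise hφ))

theorem contrapose_provable {φ ψ : Formula V ar} (h : Provable (φ.imp ψ)) :
    Provable (ψ.neg.imp φ.neg) :=
  .modusPonens (.taut fun val hn ha => by simp only [Formula.imp, hn, ha]; tauto) h

/-- By axioms T and 5, persistence of `φ` along `X` entails persistence of its negation. -/
theorem box_neg_mem (hΓ : IsTheory Γ) {X : Finset V} {φ : Formula V ar}
    (h : Provable (φ.imp (.box X φ))) (hφ : φ ∉ Γ) : .box X (.neg φ) ∈ Γ := by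
  have h1 : Formula.neg (.box X φ) ∈ Γ :=
    (hΓ.neg_mem_iff _).2 fun h' => hφ (hΓ.mp (.boxT X φ) h')
  exact hΓ.box_mono (contrapose_provable h) (hΓ.mp (.box5 X φ) h1)

/-- Two theories related by `X` agree on every formula that persists along some set of variables
depending on `X`. -/
theorem mem_iff_of_persistent (hΓ : IsTheory Γ) {Δ : Set (Formula V ar)} (hΔ : IsTheory Δ)
    {X Y : Finset V} (hs : ∀ χ, .box X χ ∈ Γ → χ ∈ Δ) (hY : ∀ y ∈ Y, .dep X y ∈ Γ)
    {φ : Formula V ar} (h : Provable (φ.imp (.box Y φ))) : φ ∈ Γ ↔ φ ∈ Δ := by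
  constructor
  · intro hφ
    exact hs _ (hΓ.box_transfer hY (hΓ.mp h hφ))
  · intro hφ
    by_contra hn
    exact (hΔ.neg_mem_iff φ).1 (hs _ (hΓ.box_transfer hY (hΓ.box_neg_mem h hn))) hφ

end IsTheory

/-- Substitution inside the necessitated theorem `𝖣_∅ (x ≡ x)` turns its right-hand `x` into `y`. -/
theorem provable_ident_imp_box (x y : V) :
    Provable ((Formula.ident x y : Formula V ar).imp (.box ∅ (.ident x y))) := by
  have h : Provable (.box ∅ (.ident x x) : Formula V ar) := .boxNec ∅ (.identRefl x)
  have h' := Provable.identSubst (ar := ar) x y (.boxBody ∅ (.identRight x))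
  refine .modusPonens (.modusPonens (.taut fun val hn ha => ?_) h) h'
  simp only [Formula.imp, hn, ha]; tauto

/-- The canonical quasi-model. -/
theorem quasiModel_isTheory (Φ : Set (Formula V ar)) :
    QuasiModel Φ fun (Γ : {Γ : Set (Formula V ar) // IsTheory Γ}) φ => φ ∈ Γ.1 where
  neg Γ _ _ := Γ.2.neg_mem_iff _
  and Γ _ _ _ := Γ.2.and_mem_iff _ _
  boxT Γ X φ _ h := Γ.2.mp (.boxT X φ) h
  depRefl Γ X x hx := Γ.2.mem_of_provable (.depRef X x hx)
  depTrans Γ _ _ _ h h' := Γ.2.dep_trans h h'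
  identRefl Γ x := Γ.2.mem_of_provable (.identRefl x)
  identSymm Γ _ _ h := Γ.2.ident_symm h
  identTrans Γ x _ _ h h' := Γ.2.subst h' (.identRight x) h
  identDep Γ X _ _ h h' := Γ.2.subst h (.depVar X) h'
  identAtom Γ _ _ _ _ _ h h' := Γ.2.atom_subst h h'
  witness := by
    rintro ⟨Γ, hΓ⟩ X φ _ h
    -- The witness extends all formulas boxed by `X` in `Γ`; they cannot derive `φ`, or `𝖣_X φ`
    -- would lie in `Γ`.
    obtain ⟨Δ, hs, hΔ, hn⟩ := exists_isTheory fun hd => h (hΓ.box_mem_of_deriv hd)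
    refine ⟨⟨Δ, hΔ⟩, fun χ _ hχ => ?_, hn⟩
    cases χ with
    | atom P z =>
      refine hΓ.mem_iff_of_persistent hΔ hs (fun y hy => ?_) (.boxIntroAtom P z)
      obtain ⟨i, -, rfl⟩ := Finset.mem_image.1 hy
      exact hχ i
    | ident x y =>
      exact hΓ.mem_iff_of_persistent hΔ hs (fun y hy => by simp at hy) (provable_ident_imp_box x y)
    | neg χ => exact hχ.elim
    | and χ χ' => exact hχ.elim
    | box Y χ => exact hΓ.mem_iff_of_persistent hΔ hs hχ (.box4 Y χ)
    | dep Y y => exact hΓ.mem_iff_of_persistent hΔ hs hχ (.boxIntroDep Y y)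

/-- The proof system is sound and complete. -/
theorem provable_iff_valid [Finite V] (φ : Formula V ar) : Provable φ ↔ Valid.{u, v, w} φ := by
  refine ⟨Provable.valid, fun h => ?_⟩
  by_contra hn
  obtain ⟨Γ, -, hΓ, hφΓ⟩ := exists_isTheory (Γ := ∅) fun hd : Deriv ∅ φ => hn hd.provable
  obtain ⟨Φ, hfin, hcl, hφ⟩ := exists_finite_isClosedSet φ
  have hfinite : Finite (Set.range fun Γ : {Γ : Set (Formula V ar) // IsTheory Γ} =>
      {χ | χ ∈ Φ ∧ χ ∈ Γ.1}) :=
    (hfin.finite_subsets.subset (by rintro _ ⟨Γ, rfl⟩ χ hχ; exact hχ.1)).to_subtype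
  obtain ⟨M, s, hs, hM⟩ := ((quasiModel_isTheory Φ).filtration hcl).exists_model hcl
    ⟨_, ⟨Γ, hΓ⟩, rfl⟩
  exact hφΓ ((hM φ hφ).1 (h M s hs)).2

end Completeness

end LFD

/-! ### Closure properties of computable predicates -/

namespace ComputablePred

variable {α : Type*} [Primcodable α] {p q : α → Prop}

open Classical in
protected theorem and (hp : ComputablePred p) (hq : ComputablePred q) :
    ComputablePred fun a => p a ∧ q a :=
  Computable.computablePred ((Primrec.and.to_comp.comp hp.decide hq.decide).of_eq fun a => by simp)

protected theorem imp (hp : ComputablePred p) (hq : ComputablePred q) :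
    ComputablePred fun a => p a → q a :=
  (hp.and hq.not).not.of_eq fun _ => by rw [not_and, not_not]

protected theorem iff (hp : ComputablePred p) (hq : ComputablePred q) :
    ComputablePred fun a => p a ↔ q a :=
  ((hp.imp hq).and (hq.imp hp)).of_eq fun _ => iff_def.symm

theorem const (p : Prop) : ComputablePred fun _ : α => p := by
  classical
  exact Computable.computablePred (Computable.const _)

/-- The index type is fixed, so the quantifier is a finite conjunction and needs no computable
structure on `ι`. This handles all quantifiers over variables and sets of variables. -/
theorem finite_forall {ι : Type*} [Finite ι] {p : ι → α → Prop}
    (hp : ∀ i, ComputablePred (p i)) : ComputablePred fun a => ∀ i, p i a := by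
  classical
  have := Fintype.ofFinite ι
  have key : ∀ s : Finset ι, ComputablePred fun a => ∀ i ∈ s, p i a := by
    intro s
    induction s using Finset.induction_on with
    | empty => exact (const True).of_eq fun a => by simp
    | insert i s _ ih => exact ((hp i).and ih).of_eq fun a => by simp
  exact (key Finset.univ).of_eq fun a => by simp

theorem finite_exists {ι : Type*} [Finite ι] {p : ι → α → Prop}
    (hp : ∀ i, ComputablePred (p i)) : ComputablePred fun a => ∃ i, p i a :=
  (finite_forall fun i => (hp i).not).not.of_eq fun a => by simp

theorem forall_lt {f : α → ℕ} (hf : Computable f) {p : α → ℕ → Prop}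
    (hp : ComputablePred fun q : α × ℕ => p q.1 q.2) :
    ComputablePred fun a => ∀ k, k < f a → p a k := by
  classical
  have hstep : Computable₂ fun (a : α) (x : ℕ × Bool) => decide (p a x.1) && x.2 :=
    Primrec.and.to_comp.comp
      (hp.decide.comp (Computable.pair .fst (Computable.fst.comp .snd)))
      (Computable.snd.comp .snd)
  have h := Computable.nat_rec hf (Computable.const true) hstep
  refine Computable.computablePred (h.of_eq fun a => ?_)
  induction f a with
  | zero => simp
  | succ n ih =>
    simp only [ih, ← Bool.decide_and, Nat.lt_succ_iff_lt_or_eq, or_imp, forall_and, forall_eq]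
    exact decide_eq_decide.2 and_comm

theorem exists_lt {f : α → ℕ} (hf : Computable f) {p : α → ℕ → Prop}
    (hp : ComputablePred fun q : α × ℕ => p q.1 q.2) :
    ComputablePred fun a => ∃ k, k < f a ∧ p a k :=
  (forall_lt (p := fun a k => ¬ p a k) hf hp.not).not.of_eq fun a => by simp

theorem eq_nat {f g : α → ℕ} (hf : Computable f) (hg : Computable g) :
    ComputablePred fun a => f a = g a := by
  have h : Computable fun x : ℕ × ℕ => decide (x.1 = x.2) :=
    (Primrec.eq (α := ℕ)).decide.to_comp
  exact Computable.computablePred (h.comp (hf.pair hg))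

theorem testBit {f g : α → ℕ} (hf : Computable f) (hg : Computable g) :
    ComputablePred fun a => (f a).testBit (g a) = true := by
  have hpow : Primrec₂ ((· ^ ·) : ℕ → ℕ → ℕ) := Primrec₂.unpaired'.1 Nat.Primrec.pow
  have h : Computable fun a => f a / 2 ^ g a % 2 :=
    Primrec.nat_mod.to_comp.comp (Primrec.nat_div.to_comp.comp hf
      (hpow.to_comp.comp (Computable.const 2) hg)) (Computable.const 2)
  exact (eq_nat h (Computable.const 1)).of_eq fun a => by
    rw [Nat.testBit_eq_decide_div_mod_eq, decide_eq_true_eq]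

end ComputablePred

theorem Computable.two_pow {α : Type*} [Primcodable α] {f : α → ℕ} (hf : Computable f) :
    Computable fun a => 2 ^ f a := by
  have hpow : Primrec₂ ((· ^ ·) : ℕ → ℕ → ℕ) := Primrec₂.unpaired'.1 Nat.Primrec.pow
  exact hpow.to_comp.comp (Computable.const 2) hf

namespace LFD

section Decidability

variable (V : Type u) [Encodable V] {Pred : Type v} [Encodable Pred] (ar : Pred → ℕ)

open Encodable

/-! ### Numerical quasi-models

Finite sets of numbers are given by binary expansions: `k` belongs to `S` if `S.testBit k`. -/

variable {V} in
/-- The code of `x ≡ y`. -/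
def identCode (x y : V) : ℕ := Nat.pair 1 (Nat.pair (encode x) (encode y))

variable {V} in
/-- The code of `D_X y`. -/
def depCode (X : Finset V) (y : V) : ℕ := Nat.pair 5 (Nat.pair (encode X) (encode y))

/-- The codes of the variables of the atom with code `k`. -/
def varList (k : ℕ) : List ℕ := Denumerable.ofNat (List ℕ) k.unpair.2.unpair.2

/-- `k` is the code of an atom `P(x₁, …, x_n)`. -/
def IsAtomCode (k : ℕ) : Prop :=
  ∃ (P : Pred) (x : Fin (ar P) → V), (Formula.atom P x).code = k

/-- `W` is a set of codes of formulas that corresponds to a closed set. -/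
def ClosedCodes (B W : ℕ) : Prop :=
  (∀ (X : Finset V) (y : V), W.testBit (depCode X y)) ∧
  (∀ x y : V, W.testBit (identCode x y)) ∧
  ∀ k, k < B → W.testBit k →
    ((k.unpair.1 = 0 → IsAtomCode V ar k) ∧
    (k.unpair.1 = 1 → ∃ x y : V, k = identCode x y)) ∧
    ((k.unpair.1 = 2 → W.testBit k.unpair.2) ∧
    (k.unpair.1 = 3 → W.testBit k.unpair.2.unpair.1 ∧ W.testBit k.unpair.2.unpair.2)) ∧
    ((k.unpair.1 = 4 →
      (∃ X : Finset V, k.unpair.2.unpair.1 = encode X) ∧ W.testBit k.unpair.2.unpair.2) ∧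
    (k.unpair.1 = 5 → ∃ (X : Finset V) (y : V), k = depCode X y)) ∧
    ∃ i : Fin 6, k.unpair.1 = i

variable {V} in
/-- The numerical version of `Step`. -/
def StepCodes (B W : ℕ) (X : Finset V) (S S' : ℕ) : Prop :=
  ((∀ x y : V, S.testBit (identCode x y) ↔ S'.testBit (identCode x y)) ∧
  ∀ (Y : Finset V) (z : V), (∀ y : Y, S.testBit (depCode X y.1)) →
    (S.testBit (depCode Y z) ↔ S'.testBit (depCode Y z))) ∧
  ∀ k, k < B → W.testBit k →
    (k.unpair.1 = 0 →
      (∀ i, i < (varList k).length → ∀ y : V, (varList k).getD i 0 = encode y →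
        S.testBit (depCode X y)) →
      (S.testBit k ↔ S'.testBit k)) ∧
    (∀ Y : Finset V, k.unpair.1 = 4 → k.unpair.2.unpair.1 = encode Y →
      (∀ y : Y, S.testBit (depCode X y.1)) →
      (S.testBit k ↔ S'.testBit k))

/-- The conditions on `S` that concern only dependence and identity atoms. -/
def AtomicConditions (S : ℕ) : Prop :=
  ((∀ (X : Finset V) (x : X), S.testBit (depCode X x.1)) ∧
  ∀ (X Y : Finset V) (z : V), (∀ y : Y, S.testBit (depCode X y.1)) →
    S.testBit (depCode Y z) → S.testBit (depCode X z)) ∧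
  ((∀ x : V, S.testBit (identCode x x)) ∧
  ∀ x y : V, S.testBit (identCode x y) → S.testBit (identCode y x)) ∧
  (∀ x y z : V, S.testBit (identCode x y) → S.testBit (identCode y z) →
    S.testBit (identCode x z)) ∧
  ∀ (X : Finset V) (x y : V), S.testBit (identCode x y) → S.testBit (depCode X x) →
    S.testBit (depCode X y)

/-- The conditions on `S` for the connectives. -/
def ConnectiveConditions (B W S : ℕ) : Prop :=
  ∀ k, k < B → W.testBit k →
    (k.unpair.1 = 2 → (S.testBit k ↔ ¬ S.testBit k.unpair.2)) ∧
    (k.unpair.1 = 3 →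
      (S.testBit k ↔ S.testBit k.unpair.2.unpair.1 ∧ S.testBit k.unpair.2.unpair.2)) ∧
    (k.unpair.1 = 4 → S.testBit k → S.testBit k.unpair.2.unpair.2)

/-- The condition on `S` for atoms with identified variables. -/
def IdentAtomCondition (B W S : ℕ) : Prop :=
  ∀ k, k < B → W.testBit k → k.unpair.1 = 0 →
    ∀ k', k' < B → W.testBit k' → k'.unpair.1 = 0 → k.unpair.2.unpair.1 = k'.unpair.2.unpair.1 →
      (∀ i, i < (varList k).length → ∀ x y : V, (varList k).getD i 0 = encode x →
        (varList k').getD i 0 = encode y → S.testBit (identCode x y)) →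
      S.testBit k → S.testBit k'

/-- Every false dependence quantification of `S` has a witness among the members of `M`. -/
def WitnessCondition (B W M S : ℕ) : Prop :=
  ∀ (X : Finset V) (k : ℕ), k < B → W.testBit k → k.unpair.1 = 4 → k.unpair.2.unpair.1 = encode X →
    ¬ S.testBit k → ∃ S', S' < 2 ^ B ∧ M.testBit S' ∧ StepCodes B W X S S' ∧
      ¬ S'.testBit k.unpair.2.unpair.2

/-- There is a quasi-model for a set of formulas with codes below `B` with a type that contains
the formula with code `n`. -/
def SatCodes (B n : ℕ) : Prop :=
  ∃ W, W < 2 ^ B ∧ ∃ M, M < 2 ^ 2 ^ B ∧ W.testBit n ∧ ClosedCodes V ar B W ∧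
    (∃ S, S < 2 ^ B ∧ M.testBit S ∧ S.testBit n) ∧
    ∀ S, S < 2 ^ B → M.testBit S → AtomicConditions V S ∧ ConnectiveConditions B W S ∧
      IdentAtomCondition V B W S ∧ WitnessCondition V B W M S

/-- Thanks to this, the argument list of an atom can be decoded as a list of numbers, without
decoding variables. -/
theorem encode_map_encode {α : Type*} [Encodable α] (l : List α) :
    encode (l.map encode) = encode l := by
  induction l with
  | nil => rfl
  | cons a l ih => rw [List.map_cons, encode_list_cons, encode_list_cons, ih, encode_nat]

variable {V ar}

theorem varList_code (P : Pred) (x : Fin (ar P) → V) :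
    varList (Formula.atom P x).code = List.ofFn fun i => encode (x i) := by
  have : (List.ofFn fun i => encode (x i)) = (List.ofFn x).map encode := by
    rw [List.map_ofFn]; rfl
  rw [varList, Formula.code, Nat.unpair_pair, Nat.unpair_pair, this, ← encode_map_encode]
  exact Denumerable.ofNat_encode _

/-- Removes the dependent type `Fin (ar P) → V`: what remains are numerical tests on the tag, the
arity and the listed variables. -/
theorem isAtomCode_iff (k : ℕ) : IsAtomCode V ar k ↔
    k.unpair.1 = 0 ∧ (∃ P : Pred, encode P = k.unpair.2.unpair.1 ∧ ar P = (varList k).length) ∧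
      ∀ i, i < (varList k).length → ∃ v : V, (varList k).getD i 0 = encode v := by
  constructor
  · rintro ⟨P, x, rfl⟩
    rw [varList_code]
    refine ⟨by simp [Formula.code], ⟨P, by simp [Formula.code]⟩, fun i hi => ?_⟩
    rw [List.length_ofFn] at hi
    exact ⟨x ⟨i, hi⟩, by simp [List.getD, hi]⟩
  · rintro ⟨h0, ⟨P, hP, har⟩, hx⟩
    choose x hx using hx
    refine ⟨P, fun i => x i (har ▸ i.2), ?_⟩
    have hl : (List.ofFn fun i : Fin (ar P) => x i (har ▸ i.2)).map encode = varList k := by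
      refine List.ext_getElem (by simp [har]) fun i h₁ h₂ => ?_
      simp [← hx i h₂, h₂]
    have henc : encode (varList k) = k.unpair.2.unpair.2 := Denumerable.encode_ofNat _
    rw [Formula.code, ← encode_map_encode, hl, henc, hP, Nat.pair_unpair, ← h0, Nat.pair_unpair]

end Decidability

/-! ### Computability of the conditions on numerical quasi-models -/

section Computability

open Encodable ComputablePred

variable {V : Type u} [Encodable V] {Pred : Type v} {ar : Pred → ℕ}
variable {α : Type*} [Primcodable α]

theorem computable_unpair_fst {f : α → ℕ} (hf : Computable f) :
    Computable fun a => (f a).unpair.1 := Computable.fst.comp (Computable.unpair.comp hf)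

theorem computable_unpair_snd {f : α → ℕ} (hf : Computable f) :
    Computable fun a => (f a).unpair.2 := Computable.snd.comp (Computable.unpair.comp hf)

theorem computable_varList {f : α → ℕ} (hf : Computable f) :
    Computable fun a => varList (f a) :=
  (Computable.ofNat (List ℕ)).comp (computable_unpair_snd (computable_unpair_snd hf))

theorem computable_varList_length {f : α → ℕ} (hf : Computable f) :
    Computable fun a => (varList (f a)).length :=
  Computable.list_length.comp (computable_varList hf)

theorem computable_varList_getD {f g : α → ℕ} (hf : Computable f) (hg : Computable g) :
    Computable fun a => (varList (f a)).getD (g a) 0 :=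
  (Primrec.list_getD 0).to_comp.comp (computable_varList hf) hg

theorem computablePred_exists_pred [Primcodable Pred] (har : Computable ar) {f g : α → ℕ}
    (hf : Computable f) (hg : Computable g) :
    ComputablePred fun a => ∃ P : Pred, encode P = f a ∧ ar P = g a := by
  classical
  -- The only candidate for `P` is the decoding of `f a`. Its code is compared with `f a` again,
  -- because `decode` may also succeed on numbers that are not codes.
  have hstep : Computable₂ fun (a : α) (P : Pred) =>
      decide (encode P = f a) && decide (ar P = g a) :=
    Primrec.and.to_comp.comp
      (eq_nat (Computable.encode.comp .snd) (hf.comp .fst)).decide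
      (eq_nat (har.comp .snd) (hg.comp .fst)).decide
  have h := Computable.option_casesOn ((Computable.decode (α := Pred)).comp hf)
    (Computable.const false) hstep
  refine (computable_iff.2 ⟨_, h, rfl⟩).of_eq fun a => ?_
  constructor
  · intro h
    cases hd : (decode (f a) : Option Pred) with
    | none => simp [hd] at h
    | some P => exact ⟨P, by simpa [hd] using h⟩
  · rintro ⟨P, hP, hg⟩
    simp [← hP, hg]

theorem computablePred_isAtomCode [Finite V] [Primcodable Pred] (har : Computable ar) {f : α → ℕ}
    (hf : Computable f) : ComputablePred fun a => IsAtomCode V ar (f a) := by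
  refine ComputablePred.of_eq ?_ fun a => (isAtomCode_iff (f a)).symm
  refine (eq_nat (computable_unpair_fst hf) (.const 0)).and ((computablePred_exists_pred har
    (computable_unpair_fst (computable_unpair_snd hf)) (computable_varList_length hf)).and ?_)
  exact forall_lt (computable_varList_length hf) <| finite_exists fun v =>
    eq_nat (computable_varList_getD (hf.comp .fst) .snd) (.const _)

variable [Finite V] {B W M S S' : α → ℕ} (hB : Computable B) (hW : Computable W)
  (hS : Computable S)

include hB hW

theorem computablePred_closedCodes [Primcodable Pred] (har : Computable ar) :
    ComputablePred fun a => ClosedCodes V ar (B a) (W a) := by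
  unfold ClosedCodes
  have hW' : Computable fun q : α × ℕ => W q.1 := hW.comp .fst
  have hk : Computable fun q : α × ℕ => q.2 := .snd
  have h1 := computable_unpair_fst hk
  have h2 := computable_unpair_snd hk
  have h21 := computable_unpair_fst h2
  have h22 := computable_unpair_snd h2
  refine .and (finite_forall fun X => finite_forall fun y => .testBit hW (.const _))
    (.and (finite_forall fun X => finite_forall fun y => .testBit hW (.const _))
    (forall_lt hB (.imp (.testBit hW' hk) (.and (.and ?_ ?_) (.and (.and ?_ ?_)
      (.and (.and ?_ ?_) ?_))))))
  · exact .imp (eq_nat h1 (.const 0)) (computablePred_isAtomCode har hk)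
  · exact .imp (eq_nat h1 (.const 1))
      (finite_exists fun x => finite_exists fun y => eq_nat hk (.const _))
  · exact .imp (eq_nat h1 (.const 2)) (.testBit hW' h2)
  · exact .imp (eq_nat h1 (.const 3)) (.and (.testBit hW' h21) (.testBit hW' h22))
  · exact .imp (eq_nat h1 (.const 4))
      (.and (finite_exists fun X => eq_nat h21 (.const _)) (.testBit hW' h22))
  · exact .imp (eq_nat h1 (.const 5))
      (finite_exists fun x => finite_exists fun y => eq_nat hk (.const _))
  · exact finite_exists fun i => eq_nat h1 (.const _)

include hS

theorem computablePred_stepCodes (hS' : Computable S') (X : Finset V) :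
    ComputablePred fun a => StepCodes (B a) (W a) X (S a) (S' a) := by
  unfold StepCodes
  have hWq : Computable fun q : α × ℕ => W q.1 := hW.comp .fst
  have hSq : Computable fun q : α × ℕ => S q.1 := hS.comp .fst
  have hSq' : Computable fun q : α × ℕ => S' q.1 := hS'.comp .fst
  have hk : Computable fun q : α × ℕ => q.2 := .snd
  have h1 := computable_unpair_fst hk
  have h21 := computable_unpair_fst (computable_unpair_snd hk)
  refine .and (.and (finite_forall fun x => finite_forall fun y =>
    .iff (.testBit hS (.const _)) (.testBit hS' (.const _)))
    (finite_forall fun Y => finite_forall fun z => .imp (finite_forall fun y =>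
      .testBit hS (.const _)) (.iff (.testBit hS (.const _)) (.testBit hS' (.const _)))))
    (forall_lt hB (.imp (.testBit hWq hk) (.and ?_ ?_)))
  · refine .imp (eq_nat h1 (.const 0)) (.imp (forall_lt (computable_varList_length hk) ?_)
      (.iff (.testBit hSq hk) (.testBit hSq' hk)))
    exact finite_forall fun y => .imp (eq_nat (computable_varList_getD (hk.comp .fst) .snd)
      (.const _)) (.testBit (hSq.comp .fst) (.const _))
  · exact finite_forall fun Y => .imp (eq_nat h1 (.const 4)) (.imp (eq_nat h21 (.const _))
      (.imp (finite_forall fun y => .testBit hSq (.const _))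
        (.iff (.testBit hSq hk) (.testBit hSq' hk))))

theorem computablePred_connectiveConditions :
    ComputablePred fun a => ConnectiveConditions (B a) (W a) (S a) := by
  unfold ConnectiveConditions
  have hWq : Computable fun q : α × ℕ => W q.1 := hW.comp .fst
  have hSq : Computable fun q : α × ℕ => S q.1 := hS.comp .fst
  have hk : Computable fun q : α × ℕ => q.2 := .snd
  have h1 := computable_unpair_fst hk
  have h2 := computable_unpair_snd hk
  have h21 := computable_unpair_fst h2
  have h22 := computable_unpair_snd h2
  exact forall_lt hB (.imp (.testBit hWq hk) (.and
    (.imp (eq_nat h1 (.const 2)) (.iff (.testBit hSq hk) (.not (.testBit hSq h2)))) (.and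
    (.imp (eq_nat h1 (.const 3)) (.iff (.testBit hSq hk)
      (.and (.testBit hSq h21) (.testBit hSq h22))))
    (.imp (eq_nat h1 (.const 4)) (.imp (.testBit hSq hk) (.testBit hSq h22))))))

theorem computablePred_identAtomCondition :
    ComputablePred fun a => IdentAtomCondition V (B a) (W a) (S a) := by
  unfold IdentAtomCondition
  have hk : Computable fun q : α × ℕ => q.2 := .snd
  have hj : Computable fun q : (α × ℕ) × ℕ => q.1.2 := Computable.snd.comp .fst
  have hj' : Computable fun q : (α × ℕ) × ℕ => q.2 := .snd
  have hWj : Computable fun q : (α × ℕ) × ℕ => W q.1.1 := hW.comp (.comp .fst .fst)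
  have hSj : Computable fun q : (α × ℕ) × ℕ => S q.1.1 := hS.comp (.comp .fst .fst)
  refine forall_lt hB (.imp (.testBit (hW.comp .fst) hk)
    (.imp (eq_nat (computable_unpair_fst hk) (.const 0))
    (forall_lt (hB.comp .fst) (.imp (.testBit hWj hj')
    (.imp (eq_nat (computable_unpair_fst hj') (.const 0))
    (.imp (eq_nat (computable_unpair_fst (computable_unpair_snd hj))
      (computable_unpair_fst (computable_unpair_snd hj')))
    (.imp ?_ (.imp (.testBit hSj hj) (.testBit hSj hj')))))))))
  exact forall_lt (computable_varList_length hj) (finite_forall fun x => finite_forall fun y =>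
    .imp (eq_nat (computable_varList_getD (hj.comp .fst) .snd) (.const _))
    (.imp (eq_nat (computable_varList_getD (hj'.comp .fst) .snd) (.const _))
    (.testBit (hSj.comp .fst) (.const _))))

theorem computablePred_witnessCondition (hM : Computable M) :
    ComputablePred fun a => WitnessCondition V (B a) (W a) (M a) (S a) := by
  unfold WitnessCondition
  have hk : Computable fun q : α × ℕ => q.2 := .snd
  have hj : Computable fun q : (α × ℕ) × ℕ => q.1.2 := Computable.snd.comp .fst
  have hj' : Computable fun q : (α × ℕ) × ℕ => q.2 := .snd
  have hp : Computable fun q : (α × ℕ) × ℕ => q.1.1 := .comp .fst .fst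
  exact finite_forall fun X => forall_lt hB (.imp (.testBit (hW.comp .fst) hk)
    (.imp (eq_nat (computable_unpair_fst hk) (.const 4))
    (.imp (eq_nat (computable_unpair_fst (computable_unpair_snd hk)) (.const _))
    (.imp (.not (.testBit (hS.comp .fst) hk))
    (exists_lt (hB.comp .fst).two_pow (.and (.testBit (hM.comp hp) hj')
    (.and (computablePred_stepCodes (hB.comp hp) (hW.comp hp) (hS.comp hp) hj' X)
    (.not (.testBit hj' (computable_unpair_snd (computable_unpair_snd hj)))))))))))

omit hB hW

theorem computablePred_atomicConditions : ComputablePred fun a => AtomicConditions V (S a) := by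
  unfold AtomicConditions
  have h : ∀ k, ComputablePred fun a => (S a).testBit k = true := fun k => .testBit hS (.const k)
  exact .and (.and (finite_forall fun X => finite_forall fun x => h _)
    (finite_forall fun X => finite_forall fun Y => finite_forall fun z =>
      .imp (finite_forall fun y => h _) (.imp (h _) (h _))))
    (.and (.and (finite_forall fun x => h _)
    (finite_forall fun x => finite_forall fun y => .imp (h _) (h _)))
    (.and (finite_forall fun x => finite_forall fun y => finite_forall fun z =>
      .imp (h _) (.imp (h _) (h _)))
    (finite_forall fun X => finite_forall fun x => finite_forall fun y =>
      .imp (h _) (.imp (h _) (h _)))))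

omit hS
include hB

theorem computablePred_satCodes [Primcodable Pred] (har : Computable ar) {f : α → ℕ}
    (hf : Computable f) : ComputablePred fun a => SatCodes V ar (B a) (f a) := by
  unfold SatCodes
  have hW : Computable fun q : (α × ℕ) × ℕ => q.1.2 := Computable.snd.comp .fst
  have hM : Computable fun q : (α × ℕ) × ℕ => q.2 := .snd
  have hp : Computable fun q : (α × ℕ) × ℕ => q.1.1 := .comp .fst .fst
  have hW' : Computable fun q : ((α × ℕ) × ℕ) × ℕ => q.1.1.2 := hW.comp .fst
  have hM' : Computable fun q : ((α × ℕ) × ℕ) × ℕ => q.1.2 := hM.comp .fst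
  have hB' : Computable fun q : ((α × ℕ) × ℕ) × ℕ => B q.1.1.1 := (hB.comp hp).comp .fst
  have hS : Computable fun q : ((α × ℕ) × ℕ) × ℕ => q.2 := .snd
  exact exists_lt hB.two_pow (exists_lt (hB.comp .fst).two_pow.two_pow
    (.and (.testBit hW (hf.comp hp)) (.and (computablePred_closedCodes (hB.comp hp) hW har)
    (.and (exists_lt (hB.comp hp).two_pow (.and (.testBit hM' hS)
      (.testBit hS ((hf.comp hp).comp .fst))))
    (forall_lt (hB.comp hp).two_pow (.imp (.testBit hM' hS)
    (.and (computablePred_atomicConditions hS)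
    (.and (computablePred_connectiveConditions hB' hW' hS)
    (.and (computablePred_identAtomCondition hB' hW' hS)
    (computablePred_witnessCondition hB' hW' hS hM'))))))))))

end Computability

end LFD

namespace LFD

/-! ### Correctness of the numerical coding -/

section Correctness

open Encodable

variable {V : Type u} [Encodable V] {Pred : Type v} [Encodable Pred] {ar : Pred → ℕ}

theorem unpair_code_atom (P : Pred) (x : Fin (ar P) → V) :
    (Formula.atom P x).code.unpair = (0, Nat.pair (encode P) (encode (List.ofFn x))) :=
  Nat.unpair_pair _ _

theorem unpair_code_ident (x y : V) :
    (Formula.ident x y : Formula V ar).code.unpair = (1, Nat.pair (encode x) (encode y)) :=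
  Nat.unpair_pair _ _

theorem unpair_code_neg (φ : Formula V ar) : φ.neg.code.unpair = (2, φ.code) :=
  Nat.unpair_pair _ _

theorem unpair_code_and (φ ψ : Formula V ar) :
    (φ.and ψ).code.unpair = (3, Nat.pair φ.code ψ.code) :=
  Nat.unpair_pair _ _

theorem unpair_code_box (X : Finset V) (φ : Formula V ar) :
    (Formula.box X φ).code.unpair = (4, Nat.pair (encode X) φ.code) :=
  Nat.unpair_pair _ _

theorem unpair_code_dep (X : Finset V) (y : V) :
    (Formula.dep X y : Formula V ar).code.unpair = (5, Nat.pair (encode X) (encode y)) :=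
  Nat.unpair_pair _ _

theorem exists_atom_of_unpair_code {χ : Formula V ar} (h : χ.code.unpair.1 = 0) :
    ∃ P z, χ = .atom P z := by
  cases χ with
  | atom P z => exact ⟨P, z, rfl⟩
  | ident x y => simp [unpair_code_ident] at h
  | neg φ => simp [unpair_code_neg] at h
  | and φ ψ => simp [unpair_code_and] at h
  | box X φ => simp [unpair_code_box] at h
  | dep X y => simp [unpair_code_dep] at h

theorem exists_box_of_unpair_code {χ : Formula V ar} (h : χ.code.unpair.1 = 4) :
    ∃ X φ, χ = .box X φ := by
  cases χ with
  | box X φ => exact ⟨X, φ, rfl⟩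
  | ident x y => simp [unpair_code_ident] at h
  | neg φ => simp [unpair_code_neg] at h
  | and φ ψ => simp [unpair_code_and] at h
  | atom P z => simp [unpair_code_atom] at h
  | dep X y => simp [unpair_code_dep] at h

theorem lt_of_testBit {B S k : ℕ} (hS : S < 2 ^ B) (hk : S.testBit k) : k < B := by
  by_contra hn
  rw [Nat.testBit_lt_two_pow (hS.trans_le (Nat.pow_le_pow_right two_pos (not_lt.1 hn)))] at hk
  exact absurd hk (by simp)

/-! ### From numerical quasi-models to models -/

variable {B W M S S' : ℕ}

theorem ClosedCodes.exists_code (hW : W < 2 ^ B) (h : ClosedCodes V ar B W) {k : ℕ}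
    (hk : W.testBit k) : ∃ φ : Formula V ar, φ.code = k := by
  induction k using Nat.strong_induction_on with
  | _ k ih =>
    obtain ⟨⟨h0, h1⟩, ⟨h2, h3⟩, ⟨h4, h5⟩, i, hi⟩ := h.2.2 k (lt_of_testBit hW hk) hk
    -- For compound formulas the tag is positive, so this makes the codes of the immediate
    -- subformulas strictly smaller than `k`.
    have hle : k.unpair.1 + k.unpair.2 ≤ k := by
      simpa only [Nat.pair_unpair] using Nat.add_le_pair k.unpair.1 k.unpair.2
    have hl := Nat.unpair_left_le k.unpair.2
    have hr := Nat.unpair_right_le k.unpair.2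
    fin_cases i <;> simp only at hi
    · obtain ⟨P, x, hx⟩ := h0 hi
      exact ⟨_, hx⟩
    · obtain ⟨x, y, hxy⟩ := h1 hi
      exact ⟨.ident x y, hxy.symm⟩
    · obtain ⟨φ, hφ⟩ := ih _ (by omega) (h2 hi)
      exact ⟨.neg φ, by rw [Formula.code, hφ, ← hi, Nat.pair_unpair]⟩
    · obtain ⟨φ, hφ⟩ := ih _ (by omega) (h3 hi).1
      obtain ⟨ψ, hψ⟩ := ih _ (by omega) (h3 hi).2
      exact ⟨.and φ ψ, by rw [Formula.code, hφ, hψ, Nat.pair_unpair, ← hi, Nat.pair_unpair]⟩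
    · obtain ⟨⟨X, hX⟩, hb⟩ := h4 hi
      obtain ⟨φ, hφ⟩ := ih _ (by omega) hb
      exact ⟨.box X φ, by rw [Formula.code, hφ, ← hX, Nat.pair_unpair, ← hi, Nat.pair_unpair]⟩
    · obtain ⟨X, y, hXy⟩ := h5 hi
      exact ⟨.dep X y, hXy.symm⟩

theorem ClosedCodes.isClosedSet (hW : W < 2 ^ B) (h : ClosedCodes V ar B W) :
    IsClosedSet {φ : Formula V ar | W.testBit φ.code} where
  neg {φ} hφ := by
    have := (h.2.2 _ (lt_of_testBit hW hφ) hφ).2.1.1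
    simp only [unpair_code_neg, true_imp_iff] at this
    exact this
  andLeft {φ ψ} hφ := by
    have := (h.2.2 _ (lt_of_testBit hW hφ) hφ).2.1.2
    simp only [unpair_code_and, Nat.unpair_pair, true_imp_iff] at this
    exact this.1
  andRight {φ ψ} hφ := by
    have := (h.2.2 _ (lt_of_testBit hW hφ) hφ).2.1.2
    simp only [unpair_code_and, Nat.unpair_pair, true_imp_iff] at this
    exact this.2
  box {X φ} hφ := by
    have := (h.2.2 _ (lt_of_testBit hW hφ) hφ).2.2.1.1
    simp only [unpair_code_box, Nat.unpair_pair, true_imp_iff] at this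
    exact this.2
  dep := h.1
  ident := h.2.1

theorem StepCodes.step (hW : W < 2 ^ B) {X : Finset V} (h : StepCodes B W X S S')
    {χ : Formula V ar} (hχ : W.testBit χ.code)
    (hd : χ.DeterminedBy {y | S.testBit (depCode X y)}) :
    S.testBit χ.code ↔ S'.testBit χ.code := by
  obtain ⟨⟨h1, h2⟩, h3⟩ := h
  have h3 := h3 _ (lt_of_testBit hW hχ) hχ
  cases χ with
  | atom P z =>
    refine h3.1 (by rw [unpair_code_atom]) fun i hi y hy => ?_
    rw [varList_code] at hi hy
    rw [List.length_ofFn] at hi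
    have : z ⟨i, hi⟩ = y := by simpa [List.getD, hi] using hy
    exact this ▸ hd ⟨i, hi⟩
  | ident x y => exact h1 x y
  | neg χ => exact hd.elim
  | and χ χ' => exact hd.elim
  | box Y χ =>
    exact h3.2 Y (by rw [unpair_code_box]) (by rw [unpair_code_box, Nat.unpair_pair])
      fun y => hd y.1 y.2
  | dep Y y => exact h2 Y y fun y => hd y.1 y.2

theorem quasiModel_of_codes (hW : W < 2 ^ B)
    (h : ∀ S, S < 2 ^ B → M.testBit S → AtomicConditions V S ∧ ConnectiveConditions B W S ∧
      IdentAtomCondition V B W S ∧ WitnessCondition V B W M S) :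
    QuasiModel {φ : Formula V ar | W.testBit φ.code}
      fun (S : {S // S < 2 ^ B ∧ M.testBit S}) φ => S.1.testBit φ.code where
  neg := by
    rintro ⟨S, hS, hM⟩ φ hφ
    simpa only [unpair_code_neg, true_imp_iff] using
      ((h S hS hM).2.1 _ (lt_of_testBit hW hφ) hφ).1
  and := by
    rintro ⟨S, hS, hM⟩ φ ψ hφ
    simpa only [unpair_code_and, Nat.unpair_pair, true_imp_iff] using
      ((h S hS hM).2.1 _ (lt_of_testBit hW hφ) hφ).2.1
  boxT := by
    rintro ⟨S, hS, hM⟩ X φ hφ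
    simpa only [unpair_code_box, Nat.unpair_pair, true_imp_iff] using
      ((h S hS hM).2.1 _ (lt_of_testBit hW hφ) hφ).2.2
  depRefl := by
    rintro ⟨S, hS, hM⟩ X x hx
    exact (h S hS hM).1.1.1 X ⟨x, hx⟩
  depTrans := by
    rintro ⟨S, hS, hM⟩ X Y z hY
    exact (h S hS hM).1.1.2 X Y z fun y => hY y.1 y.2
  identRefl := by
    rintro ⟨S, hS, hM⟩
    exact (h S hS hM).1.2.1.1
  identSymm := by
    rintro ⟨S, hS, hM⟩
    exact (h S hS hM).1.2.1.2
  identTrans := by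
    rintro ⟨S, hS, hM⟩
    exact (h S hS hM).1.2.2.1
  identDep := by
    rintro ⟨S, hS, hM⟩
    exact (h S hS hM).1.2.2.2
  identAtom := by
    rintro ⟨S, hS, hM⟩ P z z' hz hz' hi
    refine (h S hS hM).2.2.1 _ (lt_of_testBit hW hz) hz (by rw [unpair_code_atom])
      _ (lt_of_testBit hW hz') hz' (by rw [unpair_code_atom])
      (by simp only [unpair_code_atom, Nat.unpair_pair]) fun i hlt x y hx hy => ?_
    rw [varList_code] at hlt hx hy
    rw [List.length_ofFn] at hlt
    have hx : z ⟨i, hlt⟩ = x := by simpa [List.getD, hlt] using hx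
    have hy : z' ⟨i, hlt⟩ = y := by simpa [List.getD, hlt] using hy
    exact hx ▸ hy ▸ hi ⟨i, hlt⟩
  witness := by
    rintro ⟨S, hS, hM⟩ X φ hφ hn
    obtain ⟨S', hS', hM', hstep, hn'⟩ := (h S hS hM).2.2.2 X _ (lt_of_testBit hW hφ) hφ
      (by rw [unpair_code_box]) (by rw [unpair_code_box, Nat.unpair_pair]) hn
    rw [unpair_code_box, Nat.unpair_pair] at hn'
    exact ⟨⟨S', hS', hM'⟩, fun χ hχ hd => hstep.step hW hχ hd, hn'⟩

theorem SatCodes.satisfiable [Finite V] {n : ℕ} (h : SatCodes V ar B n) :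
    ∃ φ : Formula V ar, φ.code = n ∧ Satisfiable.{u, v, w} φ := by
  obtain ⟨W, hW, M, -, hn, hcl, ⟨S, hS, hM, hnS⟩, hcond⟩ := h
  obtain ⟨φ, rfl⟩ := hcl.exists_code hW hn
  obtain ⟨N, s, hs, hN⟩ := (quasiModel_of_codes (ar := ar) hW hcond).exists_model
    (hcl.isClosedSet hW) ⟨S, hS, hM⟩
  exact ⟨φ, rfl, N, s, hs, (hN φ hn).2 hnS⟩

/-! ### From models to numerical quasi-models -/

open Classical in
/-- The binary expansion of the numbers below `B` with the property `p`. -/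
noncomputable def bits (B : ℕ) (p : ℕ → Prop) : ℕ := Nat.ofBits fun i : Fin B => decide (p i)

theorem bits_lt (B : ℕ) (p : ℕ → Prop) : bits B p < 2 ^ B := Nat.ofBits_lt_two_pow _

theorem testBit_bits {B : ℕ} {p : ℕ → Prop} {k : ℕ} : (bits B p).testBit k ↔ k < B ∧ p k := by
  rw [bits, Nat.testBit_ofBits]
  split_ifs with h <;> simp [h]

/-- The codes below `B` of the formulas with the property `p`. -/
noncomputable def codeBits (B : ℕ) (p : Formula V ar → Prop) : ℕ :=
  bits B fun k => ∃ χ : Formula V ar, χ.code = k ∧ p χ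

theorem testBit_codeBits {p : Formula V ar → Prop} {χ : Formula V ar} :
    (codeBits B p).testBit χ.code ↔ χ.code < B ∧ p χ := by
  rw [codeBits, testBit_bits]
  refine and_congr_right fun _ => ⟨?_, fun h => ⟨χ, rfl, h⟩⟩
  rintro ⟨χ', h, hp⟩
  rwa [← Formula.code_injective h]

theorem exists_of_testBit_codeBits {p : Formula V ar → Prop} {k : ℕ}
    (h : (codeBits B p).testBit k) : ∃ χ : Formula V ar, χ.code = k :=
  (testBit_bits.1 h).2.imp fun _ h => h.1

theorem Formula.code_lt_of_neg {φ : Formula V ar} (h : φ.neg.code < B) : φ.code < B :=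
  (Nat.right_le_pair _ _).trans_lt h

theorem Formula.code_lt_of_and {φ ψ : Formula V ar} (h : (φ.and ψ).code < B) :
    φ.code < B ∧ ψ.code < B :=
  ⟨((Nat.left_le_pair _ _).trans (Nat.right_le_pair _ _)).trans_lt h,
    ((Nat.right_le_pair _ _).trans (Nat.right_le_pair _ _)).trans_lt h⟩

theorem Formula.code_lt_of_box {X : Finset V} {φ : Formula V ar} (h : (Formula.box X φ).code < B) :
    φ.code < B :=
  ((Nat.right_le_pair _ _).trans (Nat.right_le_pair _ _)).trans_lt h

/-- Pairing never lowers codes, so the formulas with code below `B` contain their subformulas; no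
separate subformula closure has to be computed. -/
theorem closedCodes_codeBits (hdep : ∀ (X : Finset V) (y : V), depCode X y < B)
    (hident : ∀ x y : V, identCode x y < B) :
    ClosedCodes V ar B (codeBits B fun _ : Formula V ar => True) := by
  have hmem : ∀ χ : Formula V ar, χ.code < B →
      (codeBits B fun _ : Formula V ar => True).testBit χ.code :=
    fun χ h => testBit_codeBits.2 ⟨h, trivial⟩
  refine ⟨fun X y => hmem (.dep X y) (hdep X y), fun x y => hmem (.ident x y) (hident x y),
    fun k hk hWk => ?_⟩
  obtain ⟨χ, rfl⟩ := exists_of_testBit_codeBits hWk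
  cases χ with
  | atom P z =>
    simp only [unpair_code_atom]
    exact ⟨⟨fun _ => ⟨P, z, rfl⟩, by simp⟩, by simp, by simp, 0, rfl⟩
  | ident x y =>
    simp only [unpair_code_ident]
    exact ⟨⟨by simp, fun _ => ⟨x, y, rfl⟩⟩, by simp, by simp, 1, rfl⟩
  | neg φ =>
    simp only [unpair_code_neg]
    exact ⟨by simp, ⟨fun _ => hmem φ (Formula.code_lt_of_neg hk), by simp⟩, by simp, 2, rfl⟩
  | and φ ψ =>
    simp only [unpair_code_and, Nat.unpair_pair]
    obtain ⟨h₁, h₂⟩ := Formula.code_lt_of_and hk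
    exact ⟨by simp, ⟨by simp, fun _ => ⟨hmem φ h₁, hmem ψ h₂⟩⟩, by simp, 3, rfl⟩
  | box X φ =>
    simp only [unpair_code_box, Nat.unpair_pair]
    exact ⟨by simp, by simp, ⟨fun _ => ⟨⟨X, rfl⟩, hmem φ (Formula.code_lt_of_box hk)⟩, by simp⟩,
      4, rfl⟩
  | dep X y =>
    simp only [unpair_code_dep]
    exact ⟨by simp, by simp, ⟨by simp, fun _ => ⟨X, y, rfl⟩⟩, 5, rfl⟩

section

variable {T : Type*} {val : T → Formula V ar → Prop}
  (hQ : QuasiModel (Set.univ : Set (Formula V ar)) val)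
  (hdep : ∀ (X : Finset V) (y : V), depCode X y < B) (hident : ∀ x y : V, identCode x y < B)

include hdep in
theorem testBit_depCode (t : T) (X : Finset V) (y : V) :
    (codeBits B (val t)).testBit (depCode X y) ↔ val t (.dep X y) :=
  (testBit_codeBits (χ := .dep X y)).trans (and_iff_right (hdep X y))

include hident in
theorem testBit_identCode (t : T) (x y : V) :
    (codeBits B (val t)).testBit (identCode x y) ↔ val t (.ident x y) :=
  (testBit_codeBits (χ := .ident x y)).trans (and_iff_right (hident x y))

theorem testBit_codeBits_of_le {t : T} {χ : Formula V ar} (h : χ.code < B) :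
    (codeBits B (val t)).testBit χ.code ↔ val t χ :=
  testBit_codeBits.trans (and_iff_right h)

theorem getD_varList_code {P : Pred} {z : Fin (ar P) → V} (i : Fin (ar P)) :
    (varList (Formula.atom P z).code).getD i 0 = encode (z i) := by
  simp [varList_code, List.getD]

include hdep in
theorem stepCodes_codeBits {X : Finset V} {t t' : T} (h : Step Set.univ val X t t') :
    StepCodes B (codeBits B fun _ : Formula V ar => True) X (codeBits B (val t))
      (codeBits B (val t')) := by
  have key : ∀ χ : Formula V ar, χ.DeterminedBy {y | val t (.dep X y)} →
      ((codeBits B (val t)).testBit χ.code ↔ (codeBits B (val t')).testBit χ.code) := by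
    intro χ hd
    rw [testBit_codeBits, testBit_codeBits, h χ trivial hd]
  simp only [StepCodes, testBit_depCode hdep t X]
  refine ⟨⟨fun x y => key (.ident x y) trivial, fun Y z hY => key (.dep Y z) fun y hy => hY ⟨y, hy⟩⟩,
    fun k _ hWk => ?_⟩
  obtain ⟨χ, rfl⟩ := exists_of_testBit_codeBits hWk
  cases χ with
  | atom P z =>
    refine ⟨fun _ hz => key _ fun i => hz i ?_ (z i) (getD_varList_code i),
      by simp [unpair_code_atom]⟩
    rw [varList_code, List.length_ofFn]
    exact i.2
  | box Y φ =>
    refine ⟨by simp [unpair_code_box], fun Y' _ hY' hY => key _ fun y hy => ?_⟩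
    rw [unpair_code_box, Nat.unpair_pair] at hY'
    exact hY ⟨y, encode_injective hY' ▸ hy⟩
  | ident x y => simp [unpair_code_ident]
  | neg φ => simp [unpair_code_neg]
  | and φ ψ => simp [unpair_code_and]
  | dep Y y => simp [unpair_code_dep]

include hQ hdep hident

theorem atomicConditions_codeBits (t : T) : AtomicConditions V (codeBits B (val t)) := by
  simp only [AtomicConditions, testBit_depCode hdep, testBit_identCode hident]
  exact ⟨⟨fun X x => hQ.depRefl t X x.1 x.2,
    fun X Y z hY => hQ.depTrans t X Y z fun y hy => hY ⟨y, hy⟩⟩,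
    ⟨hQ.identRefl t, hQ.identSymm t⟩, hQ.identTrans t, hQ.identDep t⟩

omit hdep hident

theorem connectiveConditions_codeBits (t : T) :
    ConnectiveConditions B (codeBits B fun _ : Formula V ar => True) (codeBits B (val t)) := by
  intro k hk hWk
  obtain ⟨χ, rfl⟩ := exists_of_testBit_codeBits hWk
  cases χ with
  | neg φ =>
    refine ⟨fun _ => ?_, by simp [unpair_code_neg], by simp [unpair_code_neg]⟩
    rw [unpair_code_neg, testBit_codeBits_of_le hk,
      testBit_codeBits_of_le (Formula.code_lt_of_neg hk)]
    exact hQ.neg t trivial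
  | and φ ψ =>
    refine ⟨by simp [unpair_code_and], fun _ => ?_, by simp [unpair_code_and]⟩
    obtain ⟨h₁, h₂⟩ := Formula.code_lt_of_and hk
    rw [unpair_code_and, Nat.unpair_pair, testBit_codeBits_of_le hk, testBit_codeBits_of_le h₁,
      testBit_codeBits_of_le h₂]
    exact hQ.and t trivial
  | box X φ =>
    refine ⟨by simp [unpair_code_box], by simp [unpair_code_box], fun _ => ?_⟩
    rw [unpair_code_box, Nat.unpair_pair, testBit_codeBits_of_le hk,
      testBit_codeBits_of_le (Formula.code_lt_of_box hk)]
    exact hQ.boxT t trivial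
  | atom P z => simp [unpair_code_atom]
  | ident x y => simp [unpair_code_ident]
  | dep X y => simp [unpair_code_dep]

include hident

theorem identAtomCondition_codeBits (t : T) :
    IdentAtomCondition V B (codeBits B fun _ : Formula V ar => True) (codeBits B (val t)) := by
  intro k hk hWk h0 k' hk' hWk' h0' heq hi
  obtain ⟨χ, rfl⟩ := exists_of_testBit_codeBits hWk
  obtain ⟨χ', rfl⟩ := exists_of_testBit_codeBits hWk'
  obtain ⟨P, z, rfl⟩ := exists_atom_of_unpair_code h0
  obtain ⟨P', z', rfl⟩ := exists_atom_of_unpair_code h0'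
  simp only [unpair_code_atom, Nat.unpair_pair, encode_inj] at heq
  subst heq
  rw [testBit_codeBits_of_le hk, testBit_codeBits_of_le hk']
  refine hQ.identAtom t trivial trivial fun i => ?_
  rw [← testBit_identCode (val := val) hident]
  refine hi i ?_ _ _ (getD_varList_code i) (getD_varList_code i)
  rw [varList_code, List.length_ofFn]
  exact i.2

omit hident
include hdep

theorem witnessCondition_codeBits (t : T) :
    WitnessCondition V B (codeBits B fun _ : Formula V ar => True)
      (bits (2 ^ B) fun S => ∃ t, S = codeBits B (val t)) (codeBits B (val t)) := by
  intro X k hk hWk h4 hX hn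
  obtain ⟨χ, rfl⟩ := exists_of_testBit_codeBits hWk
  obtain ⟨Y, φ, rfl⟩ := exists_box_of_unpair_code h4
  rw [unpair_code_box, Nat.unpair_pair] at hX
  obtain rfl := encode_injective hX
  rw [testBit_codeBits_of_le hk] at hn
  obtain ⟨t', hst, hn'⟩ := hQ.witness t trivial hn
  refine ⟨codeBits B (val t'), bits_lt _ _, testBit_bits.2 ⟨bits_lt _ _, t', rfl⟩,
    stepCodes_codeBits hdep hst, ?_⟩
  rwa [unpair_code_box, Nat.unpair_pair, testBit_codeBits_of_le (Formula.code_lt_of_box hk)]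

include hident

/-- Truncating every type to the formulas with code below `B` leaves bit sets below `2 ^ B`, however
many types there were; the set of these is the bit set `M`. -/
theorem satCodes_of_quasiModel {φ : Formula V ar} (hφ : φ.code < B) {t : T} (ht : val t φ) :
    SatCodes V ar B φ.code := by
  refine ⟨codeBits B fun _ : Formula V ar => True, bits_lt _ _,
    bits (2 ^ B) fun S => ∃ t, S = codeBits B (val t), bits_lt _ _,
    testBit_codeBits.2 ⟨hφ, trivial⟩, closedCodes_codeBits hdep hident,
    ⟨codeBits B (val t), bits_lt _ _, testBit_bits.2 ⟨bits_lt _ _, t, rfl⟩,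
      testBit_codeBits.2 ⟨hφ, ht⟩⟩, fun S _ hS => ?_⟩
  obtain ⟨-, t', rfl⟩ := testBit_bits.1 hS
  exact ⟨atomicConditions_codeBits hQ hdep hident t', connectiveConditions_codeBits hQ t',
    identAtomCondition_codeBits hQ hident t', witnessCondition_codeBits hQ hdep t'⟩

end

end Correctness

/-- Satisfiability is decidable. -/
theorem computablePred_satisfiable {V : Type u} [Finite V] [Encodable V] {Pred : Type v}
    [Primcodable Pred] {ar : Pred → ℕ} (har : Computable ar) :
    ComputablePred fun n : ℕ =>
      ∃ φ : Formula V ar, φ.code = n ∧ Satisfiable.{u, v, w} φ := by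
  -- The bound `n + (C + D + 1)` exceeds `n` and the codes of all dependence and identity atoms. The
  -- constants `C` and `D` depend only on `V` and its numbering, so the bound is computable in `n`.
  obtain ⟨C, hC⟩ := (Set.finite_range fun p : Finset V × V => depCode p.1 p.2).bddAbove
  obtain ⟨D, hD⟩ := (Set.finite_range fun p : V × V => identCode p.1 p.2).bddAbove
  have hB : Computable fun n : ℕ => n + (C + D + 1) :=
    Primrec.nat_add.to_comp.comp Computable.id (Computable.const _)
  refine (computablePred_satCodes (V := V) hB har Computable.id).of_eq fun n =>
    ⟨SatCodes.satisfiable, ?_⟩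
  rintro ⟨φ, rfl, M, s, hs, h⟩
  refine satCodes_of_quasiModel (quasiModel_states M Set.univ) (fun X y => ?_) (fun x y => ?_)
    (by omega) (t := ⟨s, hs⟩) h
  · have : depCode X y ≤ C := hC ⟨(X, y), rfl⟩
    omega
  · have : identCode x y ≤ D := hD ⟨(x, y), rfl⟩
    omega

end LFD

/-- Let `V` be a finite set of variables. For every effectively given set of predicate symbols
(computable arities), the set of Gödel numbers of satisfiable formulas is decidable. For every
set of predicate symbols whatsoever, the proof system derives exactly the valid formulas. -/
theorem mainTheorem9 {V : Type u} [Finite V] [DecidableEq V] :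
    (∀ [Encodable V] {Pred : Type v} [Primcodable Pred] (ar : Pred → ℕ), Computable ar →
      ComputablePred fun n : ℕ =>
        ∃ φ : LFD.Formula V ar, φ.code = n ∧ LFD.Satisfiable.{u, v, w} φ) ∧
    (∀ {Pred : Type v} (ar : Pred → ℕ) (φ : LFD.Formula V ar),
      LFD.Provable φ ↔ LFD.Valid.{u, v, w} φ) :=
  ⟨fun _ har => LFD.computablePred_satisfiable har, fun _ φ => LFD.provable_iff_valid φ⟩
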